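/- Let $\mathcal H$ be a complex Hilbert space of dimension larger than $1$, and let $\alpha\in(0,\pi/2)$. For a bounded linear operator $T$ on $\mathcal H$ let $W(T)=\{\langle Tx,x\rangle : x\in\mathcal H,\ \|x\|=1\}$ be its numerical range and $w(T)=\sup\{|\mu|:\mu\in W(T)\}$ its numerical radius. Put $S(\alpha)=\{a+ib : a,b\in\mathbb R,\ |b|\le a\tan\alpha\}$ and $$\tau(\alpha)=\sup\{\|T\|/w(T) : T\in\mathcal B(\mathcal H),\ T\ne 0,\ W(T)\subseteq S(\alpha)\}.$$ Put $s=\sin^2\alpha$ and let $$B=\begin{pmatrix}\cos\theta+c & \sin\alpha\\ -\sin\alpha & \cos\theta-c\end{pmatrix},\qquad c=\frac{s}{\sqrt{1+2s}},\qquad \cos\theta=\sqrt{\frac{1+s-s^2}{1+2s}} .$$ Suppose that $T\in\mathcal B(\mathcal H)$ satisfies $W(T)\subseteq S(\alpha)$, that $\|Tx\|\ne\|T\|$ for every unit vector $x\in\mathcal H$, and that $\|T\|/w(T)=\tau(\alpha)$. Let $(e_1,e_2)$ be any orthonormal pair in $\mathcal H$ and let $K=\operatorname{span}\{e_1,e_2\}$.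 Then there is a sequence $(U_m)$ of unitary operators on $\mathcal H$ such that, writing $$U_m^*TU_m/\|T\|=\begin{pmatrix}T_{11}(m)&T_{12}(m)\\ T_{21}(m)&T_{22}(m)\end{pmatrix}$$ with respect to $\mathcal H=K\oplus K^\perp$, the $2\times2$ matrices $T_{11}(m)$ (taken in the basis $(e_1,e_2)$) converge to $B/\|B\|$, where $\|B\|$ is the operator norm of $B$ on $\mathbb C^2$, and $T_{12}(m)\to0$ and $T_{21}(m)\to0$ in operator norm. -/

import Mathlib

open Filter Topology

noncomputable section

namespace SectorOperator

variable {H : Type*} [NormedAddCommGroup H] [InnerProductSpace ℂ H]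

/-- The numerical range `W(T)`. Mathlib's inner product is linear in its second argument, so
`inner ℂ x (T x)` is the number usually written `⟨Tx, x⟩`. -/
def numericalRange (T : H →L[ℂ] H) : Set ℂ :=
  {z | ∃ x : H, ‖x‖ = 1 ∧ inner ℂ x (T x) = z}

/-- The numerical radius `w(T) = sup {|μ| : μ ∈ W(T)}` (a bounded set: `|μ| ≤ ‖T‖`). -/
def numericalRadius (T : H →L[ℂ] H) : ℝ :=
  sSup {r | ∃ μ ∈ numericalRange T, ‖μ‖ = r}

/-- The sector `S(α) = {a + ib : |b| ≤ a tan α}`, for `0 ≤ α < π / 2`. -/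
def sector (α : ℝ) : Set ℂ :=
  {z | |z.im| ≤ z.re * Real.tan α}

variable (H) in
/-- `τ(α) = sup {‖T‖ / w(T) : T ∈ B(H), T ≠ 0, W(T) ⊆ S(α)}`, the optimal ratio on `H`
(a bounded set: `‖T‖ ≤ 2 w(T)` on a complex Hilbert space). -/
def tau (α : ℝ) : ℝ :=
  sSup {r | ∃ T : H →L[ℂ] H,
    T ≠ 0 ∧ numericalRange T ⊆ sector α ∧ ‖T‖ / numericalRadius T = r}

/-- The `2 × 2` matrix `B = (cos θ + c, sin α; -sin α, cos θ - c)`, where `s = sin² α`,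
`c = s / √(1 + 2s)` and `cos θ = √((1 + s - s²) / (1 + 2s))`. -/
def matrixB (α : ℝ) : Matrix (Fin 2) (Fin 2) ℂ :=
  let s : ℝ := Real.sin α ^ 2
  let c : ℝ := s / √(1 + 2 * s)
  let cosθ : ℝ := √((1 + s - s ^ 2) / (1 + 2 * s))
  !![((cosθ + c : ℝ) : ℂ), ((Real.sin α : ℝ) : ℂ);
     ((-Real.sin α : ℝ) : ℂ), ((cosθ - c : ℝ) : ℂ)]

/-- The norm of a `2 × 2` matrix as an operator on the Hilbert space `ℂ²`. -/
def opNorm (M : Matrix (Fin 2) (Fin 2) ℂ) : ℝ :=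
  ‖Matrix.toEuclideanCLM (n := Fin 2) (𝕜 := ℂ) M‖

/-- The matrix of the compression of `A` to the span of `e 0, e 1`, with respect to the
orthonormal pair `e`: the leading `2 × 2` block of `A` in an orthonormal basis that
starts with `e`. -/
def leadingBlock (e : Fin 2 → H) (A : H →L[ℂ] H) : Matrix (Fin 2) (Fin 2) ℂ :=
  Matrix.of fun i j => inner ℂ (e i) (A (e j))

/-- The block of the operator matrix of `A` that maps the closed subspace `K` to the closed
subspace `L`. -/
def block (K L : Submodule ℂ H) [L.HasOrthogonalProjection] (A : H →L[ℂ] H) : K →L[ℂ] L :=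
  L.orthogonalProjectionOnto ∘L A ∘L K.subtypeL

/-- The two-dimensional subspace spanned by an orthonormal pair. -/
def plane (e : Fin 2 → H) : Submodule ℂ H :=
  Submodule.span ℂ (Set.range e)

instance (e : Fin 2 → H) : FiniteDimensional ℂ (plane e) :=
  FiniteDimensional.span_of_finite ℂ (Set.finite_range e)

end SectorOperator

end

/-! Write `σ = sin α`, `κ = cos α`, `k = √(1 + σ² - σ⁴)`, `n = √(1 + 2σ²)`. Everything rests on one
algebraic certificate, `certificate_identity`. With `x = f + h` and `y = f - h` it expresses `-Re⟨y,
Tx⟩` as a positive multiple of two values of the forms `Re((σ ∓ iκ)T)`, nonnegative by sectoriality,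
minus half of two values of the forms `Re((k ∓ iσ²)T)`, bounded through `w(T)` because `|k ∓ iσ²|² =
1 + σ²`. The parallelogram law then gives `‖T‖ ≤ √(1 + σ²) w(T)`. The matrix `B` attains this bound,
and a copy of it, extended by zero, lives on `H` (`le_tau`); hence the extremal ratio is `√(1 +
σ²)`.

For the extremal `T`, put `S = T / ‖T‖`, choose `x` in the unit ball with `‖Sx‖` close to `1`, and
take `y = Sx`. All slack in the certificate tends to zero. A positive operator whose form vanishes
asymptotically along a bounded or unbounded sequence sends that sequence to zero, so the four slack
terms become four asymptotic linear equations between `Sf, S*f, Sh, S*h, f, h`. Solving them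
(`tendsto_near_extremal`) shows that `span{f, h}` is asymptotically invariant under both `S` and
`S*`, that is, asymptotically reducing. Compatibility of `S` with `S*` forces `f ⊥ h` in the limit
and fixes the norms (`tendsto_gram`). In the normalised pair, `S` acts in the limit as `B / n`, and
`n = ‖B‖`.

It remains to replace the approximate pair by an orthonormal one and rotate it onto `(e₁, e₂)` by a
unitary. The relations for `S` control the first column of blocks, those for `S*` the remaining
off-diagonal block. -/

namespace SectorOperator

/-! ### The certificate and the sharp norm bound -/

section Certificate

variable {H : Type*} [NormedAddCommGroup H] [InnerProductSpace ℂ H]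

/-- The numerical range lies in the sector `|Im z| κ ≤ σ Re z`. -/
def IsSectorial (σ κ : ℝ) (T : H →L[ℂ] H) : Prop :=
  ∀ x, |(inner ℂ x (T x)).im| * κ ≤ σ * (inner ℂ x (T x)).re

/-- The numerical radius is at most `w`. -/
def RadiusLE (w : ℝ) (T : H →L[ℂ] H) : Prop :=
  ∀ x, ‖inner ℂ x (T x)‖ ≤ w * ‖x‖ ^ 2

/-- Both sides are real parts of sesquilinear expressions in the four numbers `⟨f,Tf⟩, ⟨f,Th⟩,
⟨h,Tf⟩, ⟨h,Th⟩`; comparing coefficients uses only the two relations for `κ²` and `k²`. The vectors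
on the right are those on which the corresponding forms degenerate in the extremal case, as
`tendsto_contact_vectors` makes precise. -/
theorem certificate_identity {σ κ k : ℝ} (hσ : 0 < σ) (hk : 0 < k) (hσκ : σ ^ 2 + κ ^ 2 = 1)
    (hk2 : k ^ 2 = 1 + σ ^ 2 - σ ^ 4) (T : H →L[ℂ] H) (f h : H) :
    -(inner ℂ (f - h) (T (f + h))).re =
      (2 * σ * (k + 1))⁻¹ *
        (((σ - Complex.I * κ) * inner ℂ ((σ * κ : ℂ) • f - (Complex.I * (k + 1)) • h)
            (T ((σ * κ : ℂ) • f - (Complex.I * (k + 1)) • h))).re +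
          ((σ + Complex.I * κ) * inner ℂ ((σ * κ : ℂ) • f + (Complex.I * (k + 1)) • h)
            (T ((σ * κ : ℂ) • f + (Complex.I * (k + 1)) • h))).re) -
      (1 / 2) *
        (((k - Complex.I * σ ^ 2) * inner ℂ (f + Complex.I • h) (T (f + Complex.I • h))).re +
          ((k + Complex.I * σ ^ 2) * inner ℂ (f - Complex.I • h) (T (f - Complex.I • h))).re) := by
  have h1 : (2 * σ * (k + 1)) ≠ 0 := by positivity
  rw [inv_mul_eq_div, div_sub' h1, eq_div_iff h1]
  simp only [map_add, map_sub, map_smul, inner_add_left, inner_add_right, inner_sub_left,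
    inner_sub_right, inner_smul_left, inner_smul_right]
  generalize (inner ℂ f (T f) : ℂ) = ff
  generalize (inner ℂ f (T h) : ℂ) = fh
  generalize (inner ℂ h (T f) : ℂ) = hf
  generalize (inner ℂ h (T h) : ℂ) = hh
  have hs : (σ : ℂ) ^ 2 = ((σ ^ 2 : ℝ) : ℂ) := by push_cast; rfl
  rw [hs]
  simp only [Complex.add_re, Complex.sub_re, Complex.mul_re, Complex.add_im, Complex.sub_im,
    Complex.mul_im, Complex.ofReal_re, Complex.ofReal_im, Complex.I_re, Complex.I_im,
    map_mul, map_add, Complex.conj_I, Complex.conj_ofReal,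
    Complex.neg_re, Complex.neg_im, Complex.one_re, Complex.one_im, map_one]
  have hκ : κ ^ 2 = 1 - σ ^ 2 := by linarith
  ring_nf
  simp only [hκ, hk2]
  ring_nf

theorem norm_add_I_smul_sq (f h : H) :
    ‖f + Complex.I • h‖ ^ 2 + ‖f - Complex.I • h‖ ^ 2 = 2 * (‖f‖ ^ 2 + ‖h‖ ^ 2) := by
  have := parallelogram_law_with_norm ℂ f (Complex.I • h)
  rw [norm_smul, Complex.norm_I, one_mul] at this
  nlinarith

theorem norm_add_sq_add_norm_sub_sq (f h : H) :
    ‖f + h‖ ^ 2 + ‖f - h‖ ^ 2 = 2 * (‖f‖ ^ 2 + ‖h‖ ^ 2) := by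
  have := parallelogram_law_with_norm ℂ f h
  nlinarith

theorem IsSectorial.nonneg {σ κ : ℝ} {T : H →L[ℂ] H} (hT : IsSectorial σ κ T) (hκ : 0 < κ)
    (x : H) :
    0 ≤ ((σ - Complex.I * κ) * inner ℂ x (T x)).re ∧
      0 ≤ ((σ + Complex.I * κ) * inner ℂ x (T x)).re := by
  have := hT x
  have h1 := mul_le_mul_of_nonneg_right (le_abs_self (inner ℂ x (T x)).im) hκ.le
  have h2 := mul_le_mul_of_nonneg_right (neg_le_abs (inner ℂ x (T x)).im) hκ.le
  simp only [Complex.mul_re, Complex.sub_re, Complex.add_re, Complex.mul_im, Complex.sub_im,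
    Complex.add_im, Complex.ofReal_re, Complex.ofReal_im, Complex.I_re, Complex.I_im]
  constructor <;> nlinarith

theorem RadiusLE.re_le {w r : ℝ} {T : H →L[ℂ] H} (hT : RadiusLE w T) (z : ℂ)
    (hz : ‖z‖ ≤ r) (x : H) : (z * inner ℂ x (T x)).re ≤ r * w * ‖x‖ ^ 2 := by
  have hr : 0 ≤ r := (norm_nonneg z).trans hz
  calc (z * inner ℂ x (T x)).re ≤ ‖z * inner ℂ x (T x)‖ := Complex.re_le_norm _
    _ = ‖z‖ * ‖inner ℂ x (T x)‖ := norm_mul _ _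
    _ ≤ r * (w * ‖x‖ ^ 2) := mul_le_mul hz (hT x) (norm_nonneg _) hr
    _ = _ := by ring

theorem norm_coeff {σ k : ℝ} (hk2 : k ^ 2 = 1 + σ ^ 2 - σ ^ 4) :
    ‖(k - Complex.I * σ ^ 2 : ℂ)‖ = √(1 + σ ^ 2) ∧
      ‖(k + Complex.I * σ ^ 2 : ℂ)‖ = √(1 + σ ^ 2) := by
  have hs : (σ : ℂ) ^ 2 = ((σ ^ 2 : ℝ) : ℂ) := by push_cast; rfl
  rw [hs]
  constructor <;>
  · rw [Complex.norm_def]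
    congr 1
    simp [Complex.normSq_apply, -Complex.ofReal_pow]
    nlinarith

/-- The certificate at half-sum and half-difference of `x` and `y`: drop the sectorial terms and
bound the other two by the numerical radius. The parallelogram law makes the bound independent of
the mixed terms. -/
theorem re_inner_le {σ κ k w : ℝ} (hσ : 0 < σ) (hκ : 0 < κ) (hk : 0 < k)
    (hσκ : σ ^ 2 + κ ^ 2 = 1) (hk2 : k ^ 2 = 1 + σ ^ 2 - σ ^ 4) {T : H →L[ℂ] H}
    (hT : IsSectorial σ κ T) (hw : RadiusLE w T) (x y : H) :
    (inner ℂ y (T x)).re ≤ √(1 + σ ^ 2) * w * ((‖x‖ ^ 2 + ‖y‖ ^ 2) / 2) := by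
  obtain ⟨f, hf⟩ : ∃ f : H, f = (1 / 2 : ℂ) • (x + y) := ⟨_, rfl⟩
  obtain ⟨h, hh⟩ : ∃ h : H, h = (1 / 2 : ℂ) • (x - y) := ⟨_, rfl⟩
  have hx : x = f + h := by rw [hf, hh]; module
  have hy : y = f - h := by rw [hf, hh]; module
  rw [hx, hy, norm_add_sq_add_norm_sub_sq]
  have key := certificate_identity hσ hk hσκ hk2 T f h
  have h1 := (hT.nonneg hκ ((σ * κ : ℂ) • f - (Complex.I * (k + 1)) • h)).1
  have h2 := (hT.nonneg hκ ((σ * κ : ℂ) • f + (Complex.I * (k + 1)) • h)).2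
  have h3 := hw.re_le _ (norm_coeff hk2).1.le (f + Complex.I • h)
  have h4 := hw.re_le _ (norm_coeff hk2).2.le (f - Complex.I • h)
  have h5 := norm_add_I_smul_sq f h
  have h6 : 0 ≤ (2 * σ * (k + 1))⁻¹ := by positivity
  have h7 := mul_nonneg h6 (add_nonneg h1 h2)
  have h8 : √(1 + σ ^ 2) * w * ‖f + Complex.I • h‖ ^ 2 + √(1 + σ ^ 2) * w *
    ‖f - Complex.I • h‖ ^ 2 = √(1 + σ ^ 2) * w * (2 * (‖f‖ ^ 2 + ‖h‖ ^ 2)) := by rw [← h5]; ring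
  linarith

theorem norm_le_of_isSectorial {σ κ k w : ℝ} (hσ : 0 < σ) (hκ : 0 < κ) (hk : 0 < k)
    (hσκ : σ ^ 2 + κ ^ 2 = 1) (hk2 : k ^ 2 = 1 + σ ^ 2 - σ ^ 4) (hw0 : 0 ≤ w)
    {T : H →L[ℂ] H} (hT : IsSectorial σ κ T) (hw : RadiusLE w T) :
    ‖T‖ ≤ √(1 + σ ^ 2) * w := by
  refine T.opNorm_le_bound (by positivity) fun x => ?_
  by_cases hx : T x = 0
  · rw [hx, norm_zero]; positivity
  have h0 : 0 < ‖T x‖ := norm_pos_iff.2 hx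
  have hx0 : 0 < ‖x‖ := norm_pos_iff.2 fun h => hx (by rw [h, map_zero])
  -- Rescaling `T x` to the length of `x` turns the arithmetic mean of squares into the product `‖x‖
  -- ‖T x‖` wanted on the right.
  have := re_inner_le hσ hκ hk hσκ hk2 hT hw x (((‖x‖ / ‖T x‖ : ℝ) : ℂ) • T x)
  rw [norm_smul, inner_smul_left, inner_self_eq_norm_sq_to_K, Complex.norm_real,
    Real.norm_of_nonneg (by positivity), div_mul_cancel₀ _ h0.ne', Complex.conj_ofReal] at this
  have e : (((‖x‖ / ‖T x‖ : ℝ) : ℂ) * ((‖T x‖ : ℂ)) ^ 2).re = ‖x‖ * ‖T x‖ := by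
    rw [← Complex.ofReal_pow, ← Complex.ofReal_mul, Complex.ofReal_re]
    field_simp
  erw [e] at this
  nlinarith

end Certificate

/-! ### Sharpness: the matrix `B` and the value of `τ(α)` -/

section Extremal

theorem scalar_facts {α : ℝ} (hα : α ∈ Set.Ioo 0 (Real.pi / 2)) :
    0 < Real.sin α ∧ 0 < Real.cos α ∧ 0 < √(1 + Real.sin α ^ 2 - Real.sin α ^ 4) ∧
      √(1 + Real.sin α ^ 2 - Real.sin α ^ 4) ^ 2 = 1 + Real.sin α ^ 2 - Real.sin α ^ 4 ∧
      0 < √(1 + 2 * Real.sin α ^ 2) ∧ √(1 + 2 * Real.sin α ^ 2) ^ 2 = 1 + 2 * Real.sin α ^ 2 ∧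
      Real.sin α < 1 := by
  have hs : 0 < Real.sin α := Real.sin_pos_of_pos_of_lt_pi hα.1 (by linarith [hα.2, Real.pi_pos])
  have hc : 0 < Real.cos α := Real.cos_pos_of_mem_Ioo ⟨by linarith [hα.1, Real.pi_pos], hα.2⟩
  have h1 : Real.sin α < 1 := by nlinarith [Real.sin_sq_add_cos_sq α]
  have h2 : 0 < 1 + Real.sin α ^ 2 - Real.sin α ^ 4 := by
    nlinarith [pow_lt_one₀ hs.le h1 (n := 4) (by norm_num), sq_nonneg (Real.sin α)]
  exact ⟨hs, hc, Real.sqrt_pos.2 h2, Real.sq_sqrt h2.le, Real.sqrt_pos.2 (by positivity),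
    Real.sq_sqrt (by positivity), h1⟩

theorem matrixB_eq (α : ℝ) :
    matrixB α =
      !![(((√(1 + Real.sin α ^ 2 - Real.sin α ^ 4) + Real.sin α ^ 2) /
            √(1 + 2 * Real.sin α ^ 2) : ℝ) : ℂ), ((Real.sin α : ℝ) : ℂ);
        ((-Real.sin α : ℝ) : ℂ), (((√(1 + Real.sin α ^ 2 - Real.sin α ^ 4) - Real.sin α ^ 2) /
            √(1 + 2 * Real.sin α ^ 2) : ℝ) : ℂ)] := by
  have h : √((1 + Real.sin α ^ 2 - (Real.sin α ^ 2) ^ 2) / (1 + 2 * Real.sin α ^ 2)) =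
      √(1 + Real.sin α ^ 2 - Real.sin α ^ 4) / √(1 + 2 * Real.sin α ^ 2) := by
    rw [Real.sqrt_div' _ (by positivity), ← pow_mul]
  simp only [matrixB]
  rw [h, add_div, sub_div]

/-- `matrixB α` as an operator on `ℂ²`. -/
noncomputable def operatorB (α : ℝ) : EuclideanSpace ℂ (Fin 2) →L[ℂ] EuclideanSpace ℂ (Fin 2) :=
  Matrix.toEuclideanCLM (n := Fin 2) (𝕜 := ℂ) (matrixB α)

theorem operatorB_apply (α : ℝ)
    (z : EuclideanSpace ℂ (Fin 2)) :
    operatorB α z = !₂[(((√(1 + Real.sin α ^ 2 - Real.sin α ^ 4) + Real.sin α ^ 2) /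
            √(1 + 2 * Real.sin α ^ 2) : ℝ) : ℂ) * z 0 + ((Real.sin α : ℝ) : ℂ) * z 1,
        ((-Real.sin α : ℝ) : ℂ) * z 0 +
          (((√(1 + Real.sin α ^ 2 - Real.sin α ^ 4) - Real.sin α ^ 2) /
            √(1 + 2 * Real.sin α ^ 2) : ℝ) : ℂ) * z 1] := by
  ext i
  rw [operatorB, matrixB_eq]
  fin_cases i <;> simp [Matrix.ofLp_toEuclideanCLM, Matrix.mulVec, dotProduct, Fin.sum_univ_two]

/-- The diagonal of `B` is its self-adjoint part and the off-diagonal is skew-adjoint, so they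
account separately for the real and imaginary parts. -/
theorem inner_operatorB {α : ℝ} (hα : α ∈ Set.Ioo 0 (Real.pi / 2))
    (z : EuclideanSpace ℂ (Fin 2)) :
    (inner ℂ z (operatorB α z)).re = (√(1 + Real.sin α ^ 2 - Real.sin α ^ 4) + Real.sin α ^ 2) /
            √(1 + 2 * Real.sin α ^ 2) * ‖z 0‖ ^ 2 +
          (√(1 + Real.sin α ^ 2 - Real.sin α ^ 4) - Real.sin α ^ 2) /
            √(1 + 2 * Real.sin α ^ 2) * ‖z 1‖ ^ 2 ∧
      |(inner ℂ z (operatorB α z)).im| ≤ 2 * Real.sin α * (‖z 0‖ * ‖z 1‖) := by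
  have hs := (scalar_facts hα).1
  rw [operatorB_apply]
  simp only [PiLp.inner_apply, Fin.sum_univ_two, RCLike.inner_apply]
  generalize z 0 = u
  generalize z 1 = v
  generalize (√(1 + Real.sin α ^ 2 - Real.sin α ^ 4) + Real.sin α ^ 2) /
            √(1 + 2 * Real.sin α ^ 2) = a
  generalize (√(1 + Real.sin α ^ 2 - Real.sin α ^ 4) - Real.sin α ^ 2) /
            √(1 + 2 * Real.sin α ^ 2) = b
  constructor
  · simp [Complex.mul_re, Complex.mul_im, ← Complex.normSq_eq_norm_sq, Complex.normSq_apply,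
      -Complex.ofReal_sin]
    ring
  · have h1 : |(v * (starRingEnd ℂ) u).im| ≤ ‖u‖ * ‖v‖ := by
      refine (Complex.abs_im_le_norm _).trans ?_
      rw [norm_mul, RCLike.norm_conj, mul_comm]
    have h2 : ∀ t : ℝ, t = 2 * Real.sin α * (v * (starRingEnd ℂ) u).im →
        |t| ≤ 2 * Real.sin α * (‖u‖ * ‖v‖) := by
      rintro t rfl
      rw [abs_mul, abs_of_pos (by positivity)]
      exact mul_le_mul_of_nonneg_left h1 (by positivity)
    apply h2
    simp [Complex.mul_re, Complex.mul_im, -Complex.ofReal_sin]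
    ring

theorem isSectorial_operatorB {α : ℝ} (hα : α ∈ Set.Ioo 0 (Real.pi / 2)) :
    IsSectorial (Real.sin α) (Real.cos α) (operatorB α) := by
  intro z
  obtain ⟨hre, him⟩ := inner_operatorB hα z
  obtain ⟨hσ, hκ, hk, hk2, hn, hn2, hσ1⟩ := scalar_facts hα
  have hsc := Real.sin_sq_add_cos_sq α
  refine (mul_le_mul_of_nonneg_right him hκ.le).trans ?_
  rw [hre]
  generalize √(1 + Real.sin α ^ 2 - Real.sin α ^ 4) = k at *
  generalize √(1 + 2 * Real.sin α ^ 2) = n at *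
  generalize Real.sin α = σ at *
  generalize Real.cos α = κ at *
  generalize ‖z 0‖ = X at *
  generalize ‖z 1‖ = Y at *
  have hkσ : σ ^ 2 < k := by
    apply lt_of_pow_lt_pow_left₀ 2 hk.le
    nlinarith [pow_lt_one₀ hσ.le hσ1 (n := 4) (by norm_num), sq_nonneg σ]
  have h1 : 2 * κ * (X * Y) ≤ (k + σ ^ 2) / n * X ^ 2 + (k - σ ^ 2) / n * Y ^ 2 := by
    -- The diagonal entries of `B` have product `κ²`, so the sector condition is the
    -- arithmetic-geometric mean inequality.
    have e : (k + σ ^ 2) * (k - σ ^ 2) = (κ * n) ^ 2 := by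
      rw [mul_pow, hn2]; linear_combination hk2 - (1 + 2 * σ ^ 2) * hsc
    have h3 : 2 * (κ * n) * ((k + σ ^ 2) * X * Y) ≤
        ((k + σ ^ 2) * X) ^ 2 + (κ * n * Y) ^ 2 := by
      nlinarith [sq_nonneg ((k + σ ^ 2) * X - κ * n * Y)]
    have h4 : 0 < k + σ ^ 2 := by positivity
    have h5 : 2 * (κ * n) * (X * Y) ≤ (k + σ ^ 2) * X ^ 2 + (k - σ ^ 2) * Y ^ 2 := by
      refine le_of_mul_le_mul_left ?_ h4
      rw [mul_pow (κ * n), ← e] at h3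
      linarith
    rw [div_mul_eq_mul_div, div_mul_eq_mul_div, ← add_div, le_div_iff₀ hn]
    linarith
  nlinarith [mul_le_mul_of_nonneg_left h1 hσ.le]

theorem radiusLE_operatorB {α : ℝ} (hα : α ∈ Set.Ioo 0 (Real.pi / 2)) :
    RadiusLE (√(1 + 2 * Real.sin α ^ 2) / √(1 + Real.sin α ^ 2)) (operatorB α) := by
  intro z
  obtain ⟨hre, him⟩ := inner_operatorB hα z
  obtain ⟨hσ, hκ, hk, hk2, hn, hn2, hσ1⟩ := scalar_facts hα
  have ht : 0 < √(1 + Real.sin α ^ 2) := Real.sqrt_pos.2 (by positivity)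
  have ht2 : √(1 + Real.sin α ^ 2) ^ 2 = 1 + Real.sin α ^ 2 := Real.sq_sqrt (by positivity)
  refine le_of_sq_le_sq ?_ (by positivity)
  rw [← Complex.normSq_eq_norm_sq, Complex.normSq_apply, ← sq, ← sq, hre, EuclideanSpace.norm_sq_eq,
    Fin.sum_univ_two]
  have him2 : (inner ℂ z (operatorB α z)).im ^ 2 ≤
      (2 * Real.sin α * (‖z 0‖ * ‖z 1‖)) ^ 2 := by
    rw [← sq_abs]; gcongr
  refine (add_le_add_right him2 _).trans ?_
  clear him him2 hre
  generalize √(1 + Real.sin α ^ 2 - Real.sin α ^ 4) = k at *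
  generalize √(1 + 2 * Real.sin α ^ 2) = n at *
  generalize √(1 + Real.sin α ^ 2) = t at *
  generalize Real.sin α = σ at *
  rw [mul_pow (2 * σ), mul_pow 2, mul_pow ‖z 0‖, mul_pow (n / t), div_pow n, ht2]
  generalize ‖z 0‖ ^ 2 = X at *
  generalize ‖z 1‖ ^ 2 = Y at *
  -- With `X, Y` the squared moduli of the coordinates, the gap in the radius bound is a perfect
  -- square, zero exactly on the ray `(1 + σ²)(X - Y) = k(X + Y)`.
  have e : n ^ 2 / (1 + σ ^ 2) * (X + Y) ^ 2 -
      (((k + σ ^ 2) / n * X + (k - σ ^ 2) / n * Y) ^ 2 + 2 ^ 2 * σ ^ 2 * (X * Y)) =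
      σ ^ 2 / (n ^ 2 * (1 + σ ^ 2)) * ((1 + σ ^ 2) * (X - Y) - k * (X + Y)) ^ 2 := by
    have h1 : (1 + σ ^ 2) ≠ 0 := by positivity
    field_simp
    have h4 : n ^ 4 = (1 + 2 * σ ^ 2) ^ 2 := by rw [← hn2]; ring
    ring_nf
    simp only [hn2, hk2, h4]
    ring
  have : 0 ≤ σ ^ 2 / (n ^ 2 * (1 + σ ^ 2)) * ((1 + σ ^ 2) * (X - Y) - k * (X + Y)) ^ 2 := by
    positivity
  linarith

theorem exists_operatorB_norm_eq {α : ℝ} (hα : α ∈ Set.Ioo 0 (Real.pi / 2)) :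
    ∃ z : EuclideanSpace ℂ (Fin 2), z ≠ 0 ∧
      ‖operatorB α z‖ = √(1 + 2 * Real.sin α ^ 2) * ‖z‖ := by
  obtain ⟨hσ, hκ, hk, hk2, hn, hn2, hσ1⟩ := scalar_facts hα
  set k := √(1 + Real.sin α ^ 2 - Real.sin α ^ 4) with hkd
  set n := √(1 + 2 * Real.sin α ^ 2) with hnd
  have hnC : (n : ℂ) ≠ 0 := by exact_mod_cast hn.ne'
  have hk2C : (k : ℂ) ^ 2 = 1 + (Real.sin α : ℂ) ^ 2 - (Real.sin α : ℂ) ^ 4 := by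
    exact_mod_cast hk2
  have hn2C : (n : ℂ) ^ 2 = 1 + 2 * (Real.sin α : ℂ) ^ 2 := by exact_mod_cast hn2
  -- `diag(1, -1) B` is symmetric with eigenvalues `n` and `-1/n`; this is an eigenvector for `n`,
  -- so `B` stretches it by `n`.
  refine ⟨!₂[((Real.sin α : ℝ) : ℂ), ((n - (k + Real.sin α ^ 2) / n : ℝ) : ℂ)], ?_, ?_⟩
  · intro h
    have := congrArg (fun z : EuclideanSpace ℂ (Fin 2) => z 0) h
    simp [-Complex.ofReal_sin] at this
    exact hσ.ne' this
  · have : operatorB α !₂[((Real.sin α : ℝ) : ℂ), ((n - (k + Real.sin α ^ 2) / n : ℝ) : ℂ)] =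
        (n : ℂ) • !₂[((Real.sin α : ℝ) : ℂ), -((n - (k + Real.sin α ^ 2) / n : ℝ) : ℂ)] := by
      rw [operatorB_apply, ← hkd, ← hnd]
      ext i
      fin_cases i
      · simp [-Complex.ofReal_sin]
        ring
      · simp [-Complex.ofReal_sin]
        field_simp
        have h4 : (n : ℂ) ^ 4 = (1 + 2 * (Real.sin α : ℂ) ^ 2) ^ 2 := by rw [← hn2C]; ring
        ring_nf
        simp only [hn2C, hk2C, h4]
        ring
    rw [this, norm_smul, Complex.norm_real, Real.norm_of_nonneg hn.le]
    congr 1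
    simp only [EuclideanSpace.norm_eq, Fin.sum_univ_two]
    simp only [Matrix.cons_val_zero, Matrix.cons_val_one, norm_neg]

theorem opNorm_matrixB {α : ℝ} (hα : α ∈ Set.Ioo 0 (Real.pi / 2)) :
    opNorm (matrixB α) = √(1 + 2 * Real.sin α ^ 2) := by
  obtain ⟨hσ, hκ, hk, hk2, hn, hn2, hσ1⟩ := scalar_facts hα
  change ‖operatorB α‖ = _
  apply le_antisymm
  · refine (norm_le_of_isSectorial hσ hκ hk (Real.sin_sq_add_cos_sq α) hk2 (by positivity)
      (isSectorial_operatorB hα) (radiusLE_operatorB hα)).trans_eq ?_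
    have ht : √(1 + Real.sin α ^ 2) ≠ 0 := (Real.sqrt_pos.2 (by positivity)).ne'
    field_simp
  · obtain ⟨z, hz, hzn⟩ := exists_operatorB_norm_eq hα
    have := (operatorB α).le_opNorm z
    rw [hzn] at this
    exact le_of_mul_le_mul_right this (norm_pos_iff.2 hz)

variable {H : Type*} [NormedAddCommGroup H] [InnerProductSpace ℂ H]

theorem inner_smul_self_apply (T : H →L[ℂ] H) (c : ℝ) (x : H) :
    inner ℂ ((c : ℂ) • x) (T ((c : ℂ) • x)) = ((c ^ 2 : ℝ) : ℂ) * inner ℂ x (T x) := by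
  rw [map_smul, inner_smul_left, inner_smul_right, Complex.conj_ofReal]
  push_cast; ring

theorem isSectorial_of_numericalRange_subset {α : ℝ} (hα : α ∈ Set.Ioo 0 (Real.pi / 2))
    {T : H →L[ℂ] H} (hT : numericalRange T ⊆ sector α) :
    IsSectorial (Real.sin α) (Real.cos α) T := by
  have hκ := (scalar_facts hα).2.1
  intro x
  by_cases hx : x = 0
  · simp [hx]
  have h0 : 0 < ‖x‖ := norm_pos_iff.2 hx
  have h := hT ⟨((‖x‖⁻¹ : ℝ) : ℂ) • x, by
    rw [norm_smul, Complex.norm_real, Real.norm_of_nonneg (by positivity),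
      inv_mul_cancel₀ h0.ne'], rfl⟩
  rw [sector, Set.mem_ofPred_eq, inner_smul_self_apply, Complex.im_ofReal_mul, Complex.re_ofReal_mul,
    abs_mul, abs_of_nonneg (by positivity), Real.tan_eq_sin_div_cos, ← mul_div_assoc,
    le_div_iff₀ hκ, mul_assoc, mul_assoc] at h
  have := le_of_mul_le_mul_left h (by positivity)
  linarith

theorem numericalRange_subset_of_isSectorial {α : ℝ} (hα : α ∈ Set.Ioo 0 (Real.pi / 2))
    {T : H →L[ℂ] H} (hT : IsSectorial (Real.sin α) (Real.cos α) T) :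
    numericalRange T ⊆ sector α := by
  rintro _ ⟨x, -, rfl⟩
  rw [sector, Set.mem_ofPred_eq, Real.tan_eq_sin_div_cos, ← mul_div_assoc,
    le_div_iff₀ (scalar_facts hα).2.1, mul_comm (Complex.re _)]
  exact hT x

theorem numericalRadius_nonneg (T : H →L[ℂ] H) : 0 ≤ numericalRadius T := by
  refine Real.sSup_nonneg ?_
  rintro _ ⟨μ, -, rfl⟩
  exact norm_nonneg _

theorem numericalRadius_le {T : H →L[ℂ] H} {w : ℝ} (hw : 0 ≤ w) (hT : RadiusLE w T) :
    numericalRadius T ≤ w := by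
  refine Real.sSup_le ?_ hw
  rintro _ ⟨_, ⟨x, hx, rfl⟩, rfl⟩
  simpa [hx] using hT x

theorem radiusLE_numericalRadius (T : H →L[ℂ] H) : RadiusLE (numericalRadius T) T := by
  intro x
  by_cases hx : x = 0
  · simp [hx]
  have h0 : 0 < ‖x‖ := norm_pos_iff.2 hx
  have hb : BddAbove {r | ∃ μ ∈ numericalRange T, ‖μ‖ = r} := by
    refine ⟨‖T‖, ?_⟩
    rintro _ ⟨_, ⟨y, hy, rfl⟩, rfl⟩
    refine (norm_inner_le_norm _ _).trans ?_
    rw [hy, one_mul]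
    simpa [hy] using T.le_opNorm y
  have h : ‖inner ℂ (((‖x‖⁻¹ : ℝ) : ℂ) • x) (T (((‖x‖⁻¹ : ℝ) : ℂ) • x))‖ ≤ numericalRadius T := by
    refine le_csSup hb ⟨_, ⟨((‖x‖⁻¹ : ℝ) : ℂ) • x, ?_, rfl⟩, rfl⟩
    rw [norm_smul, Complex.norm_real, Real.norm_of_nonneg (by positivity),
      inv_mul_cancel₀ h0.ne']
  rw [inner_smul_self_apply, norm_mul, Complex.norm_real, Real.norm_of_nonneg (by positivity),
    inv_pow, inv_mul_le_iff₀ (by positivity)] at h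
  linarith

theorem norm_le_numericalRadius {α : ℝ} (hα : α ∈ Set.Ioo 0 (Real.pi / 2)) {T : H →L[ℂ] H}
    (hT : numericalRange T ⊆ sector α) :
    ‖T‖ ≤ √(1 + Real.sin α ^ 2) * numericalRadius T := by
  obtain ⟨hσ, hκ, hk, hk2, -⟩ := scalar_facts hα
  exact norm_le_of_isSectorial hσ hκ hk (Real.sin_sq_add_cos_sq α) hk2 (numericalRadius_nonneg T)
    (isSectorial_of_numericalRange_subset hα hT) (radiusLE_numericalRadius T)

/-- The isometric embedding of `ℂ²` along an orthonormal pair. -/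
noncomputable def embedding {e : Fin 2 → H} (he : Orthonormal ℂ e) : EuclideanSpace ℂ (Fin 2) →ₗᵢ[ℂ] H :=
  ((EuclideanSpace.basisFun (Fin 2) ℂ).toBasis.constr ℂ e).isometryOfOrthonormal
    (v := (EuclideanSpace.basisFun (Fin 2) ℂ).toBasis)
    (by rw [OrthonormalBasis.coe_toBasis]; exact OrthonormalBasis.orthonormal _)
    (by
      have h : ⇑((EuclideanSpace.basisFun (Fin 2) ℂ).toBasis.constr ℂ e) ∘
          (EuclideanSpace.basisFun (Fin 2) ℂ).toBasis = e :=
        funext fun i => Module.Basis.constr_basis _ _ _ i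
      rw [h]; exact he)

/-- The operator `V B V*`, with `V` the embedding of `ℂ²`, inherits sectoriality and the radius
bound because `⟨x, VBV*x⟩ = ⟨V*x, BV*x⟩` and `‖V*x‖ ≤ ‖x‖`. The general norm bound makes the
supremum finite, so this ratio lies below it. -/
theorem le_tau [CompleteSpace H] {α : ℝ} (hα : α ∈ Set.Ioo 0 (Real.pi / 2)) {e : Fin 2 → H}
    (he : Orthonormal ℂ e) : √(1 + Real.sin α ^ 2) ≤ tau H α := by
  obtain ⟨hσ, hκ, hk, hk2, hn, hn2, hσ1⟩ := scalar_facts hα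
  have ht : 0 < √(1 + Real.sin α ^ 2) := Real.sqrt_pos.2 (by positivity)
  set V := (embedding he).toContinuousLinearMap with hV
  set T : H →L[ℂ] H := V ∘L operatorB α ∘L V.adjoint with hTdef
  have hin : ∀ x, inner ℂ x (T x) = inner ℂ (V.adjoint x) (operatorB α (V.adjoint x)) := by
    intro x
    rw [ContinuousLinearMap.adjoint_inner_left]
    rfl
  have hVn : ∀ z, ‖V z‖ = ‖z‖ := fun z => (embedding he).norm_map z
  have hVV : ∀ z, V.adjoint (V z) = z := by
    intro z
    refine ext_inner_right ℂ fun y => ?_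
    rw [ContinuousLinearMap.adjoint_inner_left]
    exact (embedding he).inner_map_map z y
  have hVa : ∀ x, ‖V.adjoint x‖ ≤ ‖x‖ := by
    intro x
    have h1 : ‖V.adjoint‖ ≤ 1 := by
      rw [LinearIsometryEquiv.norm_map]
      exact V.opNorm_le_bound zero_le_one fun z => by rw [hVn, one_mul]
    simpa using V.adjoint.le_of_opNorm_le h1 x
  have hsec : numericalRange T ⊆ sector α := by
    refine numericalRange_subset_of_isSectorial hα fun x => ?_
    rw [hin]
    exact isSectorial_operatorB hα _
  have hrad : RadiusLE (√(1 + 2 * Real.sin α ^ 2) / √(1 + Real.sin α ^ 2)) T := by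
    intro x
    rw [hin]
    refine (radiusLE_operatorB hα _).trans ?_
    gcongr
    exact hVa x
  have hTn : √(1 + 2 * Real.sin α ^ 2) ≤ ‖T‖ := by
    obtain ⟨z, hz, hzn⟩ := exists_operatorB_norm_eq hα
    have h1 := T.le_opNorm (V z)
    have h2 : T (V z) = V (operatorB α z) := by
      simp only [hTdef, ContinuousLinearMap.comp_apply, hVV]
    rw [h2, hVn, hVn, hzn] at h1
    exact le_of_mul_le_mul_right h1 (norm_pos_iff.2 hz)
  have hT0 : 0 < ‖T‖ := hn.trans_le hTn
  have hw0 : 0 < numericalRadius T := by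
    have := norm_le_numericalRadius hα hsec
    exact (pos_iff_pos_of_mul_pos (hT0.trans_le this)).1 ht
  have hratio : √(1 + Real.sin α ^ 2) ≤ ‖T‖ / numericalRadius T := by
    rw [le_div_iff₀ hw0]
    have h1 := numericalRadius_le (by positivity) hrad
    rw [le_div_iff₀ ht] at h1
    linarith
  refine hratio.trans (le_csSup ⟨√(1 + Real.sin α ^ 2), ?_⟩ ⟨T, norm_pos_iff.1 hT0, hsec, rfl⟩)
  rintro _ ⟨R, -, hR, rfl⟩
  exact div_le_of_le_mul₀ (numericalRadius_nonneg R) ht.le (norm_le_numericalRadius hα hR)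

end Extremal

/-! ### Vanishing slack and the asymptotic action of `S` and `S*` -/

section NearExtremal

variable {H : Type*} [NormedAddCommGroup H] [InnerProductSpace ℂ H]

theorem norm_apply_sq_le {P : H →L[ℂ] H} (hP : ∀ x y, inner ℂ (P x) y = inner ℂ x (P y))
    (hpos : ∀ x, 0 ≤ (inner ℂ x (P x)).re) (x : H) :
    ‖P x‖ ^ 2 ≤ ‖P‖ * (inner ℂ x (P x)).re := by
  by_cases h0 : ‖P‖ = 0
  · have : P = 0 := norm_eq_zero.1 h0
    simp [this]
  have hM : 0 < ‖P‖ := lt_of_le_of_ne (norm_nonneg _) (Ne.symm h0)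
  -- Positivity at a gradient step of length `1/‖P‖` replaces the square root of `P`: expanding
  -- leaves `⟨x,Px⟩ ≥ ‖Px‖² / ‖P‖`.
  have h := hpos (x - ((‖P‖⁻¹ : ℝ) : ℂ) • P x)
  have e1 : inner ℂ x (P (P x)) = ((‖P x‖ ^ 2 : ℝ) : ℂ) := by
    rw [← hP, inner_self_eq_norm_sq_to_K]; push_cast; rfl
  have e2 : inner ℂ (P x) (P x) = ((‖P x‖ ^ 2 : ℝ) : ℂ) := by
    rw [inner_self_eq_norm_sq_to_K]; push_cast; rfl
  have h3 : (inner ℂ (P x) (P (P x))).re ≤ ‖P‖ * ‖P x‖ ^ 2 := by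
    refine (Complex.re_le_norm _).trans ((norm_inner_le_norm _ _).trans ?_)
    nlinarith [P.le_opNorm (P x), norm_nonneg (P x)]
  rw [map_sub, map_smul, inner_sub_left, inner_sub_right, inner_sub_right, inner_smul_left,
    inner_smul_left, inner_smul_right, inner_smul_right, e1, e2, Complex.conj_ofReal] at h
  simp only [Complex.sub_re, Complex.re_ofReal_mul, Complex.ofReal_re] at h
  have h4 : ‖P‖⁻¹ * (‖P‖⁻¹ * (inner ℂ (P x) (P (P x))).re) ≤ ‖P‖⁻¹ * ‖P x‖ ^ 2 := by
    gcongr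
    rw [inv_mul_le_iff₀ hM]
    exact h3
  have h5 : ‖P‖⁻¹ * ‖P x‖ ^ 2 ≤ (inner ℂ x (P x)).re := by linarith
  rwa [inv_mul_le_iff₀ hM] at h5

theorem tendsto_apply_zero {P : H →L[ℂ] H} (hP : ∀ x y, inner ℂ (P x) y = inner ℂ x (P y))
    (hpos : ∀ x, 0 ≤ (inner ℂ x (P x)).re) {u : ℕ → H}
    (hu : Tendsto (fun m => (inner ℂ (u m) (P (u m))).re) atTop (𝓝 0)) :
    Tendsto (fun m => P (u m)) atTop (𝓝 0) := by
  rw [tendsto_zero_iff_norm_tendsto_zero]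
  have h : Tendsto (fun m => ‖P (u m)‖ ^ 2) atTop (𝓝 0) := by
    refine squeeze_zero (fun _ => by positivity) (fun m => norm_apply_sq_le hP hpos (u m)) ?_
    simpa using hu.const_mul ‖P‖
  simpa using h.sqrt

variable [CompleteSpace H]

/-- Twice the real part of `z T`. -/
noncomputable def twiceRe (z : ℂ) (T : H →L[ℂ] H) : H →L[ℂ] H :=
  z • T + (starRingEnd ℂ z) • T.adjoint

theorem twiceRe_symm (z : ℂ) (T : H →L[ℂ] H) (x y : H) :
    inner ℂ (twiceRe z T x) y = inner ℂ x (twiceRe z T y) := by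
  simp only [twiceRe, add_apply, smul_apply,
    inner_add_left, inner_add_right, inner_smul_left, inner_smul_right,
    ContinuousLinearMap.adjoint_inner_left, ContinuousLinearMap.adjoint_inner_right,
    Complex.conj_conj]
  ring

theorem re_inner_twiceRe (z : ℂ) (T : H →L[ℂ] H) (x : H) :
    (inner ℂ x (twiceRe z T x)).re = 2 * (z * inner ℂ x (T x)).re := by
  have : inner ℂ (T x) x = (starRingEnd ℂ) (inner ℂ x (T x)) := (inner_conj_symm _ _).symm
  simp only [twiceRe, add_apply, smul_apply,
    inner_add_right, inner_smul_right, ContinuousLinearMap.adjoint_inner_right, this,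
    ← map_mul, Complex.add_re, Complex.conj_re]
  ring

omit [CompleteSpace H] in
-- Here `g₁, g₂, g₃, g₄` stand for `Sf, S*f, Sh, S*h`. The equations decouple into two `2 × 2`
-- systems, one in `g₁ + g₂, g₃ - g₄` and one in `g₁ - g₂, g₃ + g₄`, with determinants `(k + 1 +
-- σ²)/4` and `(k + σ²)/4`.
theorem tendsto_of_linear_system {σ κ k : ℝ} (hσ : 0 < σ) (hk : 0 < k)
    (hσκ : σ ^ 2 + κ ^ 2 = 1) (hk2 : k ^ 2 = 1 + σ ^ 2 - σ ^ 4) {f h g₁ g₂ g₃ g₄ : ℕ → H}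
    (hU₁ : Tendsto (fun m => ((σ ^ 2 / 2 : ℝ) : ℂ) • (g₁ m + g₂ m) -
      (((k + 1) / 2 : ℝ) : ℂ) • (g₃ m - g₄ m)) atTop (𝓝 0))
    (hV₁ : Tendsto (fun m => f m - ((k / 2 : ℝ) : ℂ) • (g₁ m + g₂ m) -
      ((σ ^ 2 / 2 : ℝ) : ℂ) • (g₃ m - g₄ m)) atTop (𝓝 0))
    (hU₂ : Tendsto (fun m => ((κ ^ 2 / 2 : ℝ) : ℂ) • (g₁ m - g₂ m) +
      (((k + 1) / 2 : ℝ) : ℂ) • (g₃ m + g₄ m)) atTop (𝓝 0))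
    (hV₂ : Tendsto (fun m => h m - ((k / 2 : ℝ) : ℂ) • (g₃ m + g₄ m) +
      ((σ ^ 2 / 2 : ℝ) : ℂ) • (g₁ m - g₂ m)) atTop (𝓝 0)) :
    Tendsto (fun m => g₁ m - (((k + σ ^ 2) / (1 + 2 * σ ^ 2) : ℝ) : ℂ) • f m +
      (((1 + σ ^ 2 + k) / (1 + 2 * σ ^ 2) : ℝ) : ℂ) • h m) atTop (𝓝 0) ∧
    Tendsto (fun m => g₂ m - (((k + σ ^ 2) / (1 + 2 * σ ^ 2) : ℝ) : ℂ) • f m -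
      (((1 + σ ^ 2 + k) / (1 + 2 * σ ^ 2) : ℝ) : ℂ) • h m) atTop (𝓝 0) ∧
    Tendsto (fun m => g₃ m - (((k - σ ^ 2) / (1 + 2 * σ ^ 2) : ℝ) : ℂ) • h m -
      (((1 + σ ^ 2 - k) / (1 + 2 * σ ^ 2) : ℝ) : ℂ) • f m) atTop (𝓝 0) ∧
    Tendsto (fun m => g₄ m - (((k - σ ^ 2) / (1 + 2 * σ ^ 2) : ℝ) : ℂ) • h m +
      (((1 + σ ^ 2 - k) / (1 + 2 * σ ^ 2) : ℝ) : ℂ) • f m) atTop (𝓝 0) := by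
  have a0 : k + 1 + σ ^ 2 ≠ 0 := by positivity
  have b0 : k + σ ^ 2 ≠ 0 := by positivity
  have n0 : 1 + 2 * σ ^ 2 ≠ 0 := by positivity
  have hκ : κ ^ 2 = 1 - σ ^ 2 := by linarith
  -- The target coefficients are rewritten with these determinants as denominators, the form in
  -- which Cramer's rule produces them.
  have e₁ : (k + σ ^ 2) / (1 + 2 * σ ^ 2) = (k + 1) / (k + 1 + σ ^ 2) := by
    rw [div_eq_div_iff n0 a0]; linear_combination hk2
  have e₂ : (1 + σ ^ 2 + k) / (1 + 2 * σ ^ 2) = (k + 1) / (k + σ ^ 2) := by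
    rw [div_eq_div_iff n0 b0]; linear_combination hk2
  have e₃ : (1 + σ ^ 2 - k) / (1 + 2 * σ ^ 2) = σ ^ 2 / (k + 1 + σ ^ 2) := by
    rw [div_eq_div_iff n0 a0]; linear_combination -hk2
  have e₄ : (k - σ ^ 2) / (1 + 2 * σ ^ 2) = κ ^ 2 / (k + σ ^ 2) := by
    rw [div_eq_div_iff n0 b0]; linear_combination hk2 - (1 + 2 * σ ^ 2) * hκ
  rw [e₁, e₂, e₃, e₄]
  have comb : ∀ c₁ c₂ c₃ c₄ : ℝ, Tendsto (fun m => (c₁ : ℂ) • (((σ ^ 2 / 2 : ℝ) : ℂ) •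
      (g₁ m + g₂ m) - (((k + 1) / 2 : ℝ) : ℂ) • (g₃ m - g₄ m)) +
      (c₂ : ℂ) • (f m - ((k / 2 : ℝ) : ℂ) • (g₁ m + g₂ m) -
        ((σ ^ 2 / 2 : ℝ) : ℂ) • (g₃ m - g₄ m)) +
      (c₃ : ℂ) • (((κ ^ 2 / 2 : ℝ) : ℂ) • (g₁ m - g₂ m) +
        (((k + 1) / 2 : ℝ) : ℂ) • (g₃ m + g₄ m)) +
      (c₄ : ℂ) • (h m - ((k / 2 : ℝ) : ℂ) • (g₃ m + g₄ m) +
        ((σ ^ 2 / 2 : ℝ) : ℂ) • (g₁ m - g₂ m))) atTop (𝓝 0) := by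
    intro c₁ c₂ c₃ c₄
    simpa using (((hU₁.const_smul (c₁ : ℂ)).add (hV₁.const_smul (c₂ : ℂ))).add
      (hU₂.const_smul (c₃ : ℂ))).add (hV₂.const_smul (c₄ : ℂ))
  have aC : (k + 1 + σ ^ 2 : ℂ) ≠ 0 := by exact_mod_cast a0
  have bC : (k + σ ^ 2 : ℂ) ≠ 0 := by exact_mod_cast b0
  have kC : (k : ℂ) ^ 2 = 1 + σ ^ 2 - σ ^ 4 := by exact_mod_cast hk2
  refine ⟨?_, ?_, ?_, ?_⟩
  · convert comb (σ ^ 2 / (k + 1 + σ ^ 2)) (-(k + 1) / (k + 1 + σ ^ 2)) (k / (k + σ ^ 2))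
      ((k + 1) / (k + σ ^ 2)) using 2 with m
    rw [hκ]
    clear comb hU₁ hV₁ hU₂ hV₂
    match_scalars <;> field_simp <;> grind only
  · convert comb (σ ^ 2 / (k + 1 + σ ^ 2)) (-(k + 1) / (k + 1 + σ ^ 2)) (-k / (k + σ ^ 2))
      (-(k + 1) / (k + σ ^ 2)) using 2 with m
    rw [hκ]
    clear comb hU₁ hV₁ hU₂ hV₂
    match_scalars <;> field_simp <;> grind only
  · convert comb (-k / (k + 1 + σ ^ 2)) (-σ ^ 2 / (k + 1 + σ ^ 2)) (σ ^ 2 / (k + σ ^ 2))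
      (-κ ^ 2 / (k + σ ^ 2)) using 2 with m
    rw [hκ]
    clear comb hU₁ hV₁ hU₂ hV₂
    match_scalars <;> field_simp <;> grind only
  · convert comb (k / (k + 1 + σ ^ 2)) (σ ^ 2 / (k + 1 + σ ^ 2)) (σ ^ 2 / (k + σ ^ 2))
      (-κ ^ 2 / (k + σ ^ 2)) using 2 with m
    rw [hκ]
    clear comb hU₁ hV₁ hU₂ hV₂
    match_scalars <;> field_simp <;> grind only

/-- The deficit is a positive combination of four nonnegative slack terms, so each is at most a
constant times the deficit and tends to zero; `tendsto_apply_zero` upgrades this from forms to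
vectors. -/
theorem tendsto_contact_vectors {σ κ k : ℝ} (hσ : 0 < σ) (hκ : 0 < κ) (hk : 0 < k)
    (hσκ : σ ^ 2 + κ ^ 2 = 1) (hk2 : k ^ 2 = 1 + σ ^ 2 - σ ^ 4) {S : H →L[ℂ] H}
    (hS : IsSectorial σ κ S) (hw : RadiusLE (√(1 + σ ^ 2))⁻¹ S) {f h : ℕ → H}
    (hfh : Tendsto (fun m => ‖f m‖ ^ 2 + ‖h m‖ ^ 2 -
      (inner ℂ (f m - h m) (S (f m + h m))).re) atTop (𝓝 0)) :
    Tendsto (fun m => twiceRe (σ - Complex.I * κ) S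
      ((σ * κ : ℂ) • f m - (Complex.I * (k + 1)) • h m)) atTop (𝓝 0) ∧
    Tendsto (fun m => twiceRe (σ + Complex.I * κ) S
      ((σ * κ : ℂ) • f m + (Complex.I * (k + 1)) • h m)) atTop (𝓝 0) ∧
    Tendsto (fun m => ((2 : ℂ) • ContinuousLinearMap.id ℂ H - twiceRe (k - Complex.I * σ ^ 2) S)
      (f m + Complex.I • h m)) atTop (𝓝 0) ∧
    Tendsto (fun m => ((2 : ℂ) • ContinuousLinearMap.id ℂ H - twiceRe (k + Complex.I * σ ^ 2) S)
      (f m - Complex.I • h m)) atTop (𝓝 0) := by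
  have ht : √(1 + σ ^ 2) * (√(1 + σ ^ 2))⁻¹ = 1 :=
    mul_inv_cancel₀ (Real.sqrt_pos.2 (by positivity)).ne'
  have hD : ∀ (z : ℂ) (x : H), (inner ℂ x (((2 : ℂ) • ContinuousLinearMap.id ℂ H -
      twiceRe z S) x)).re = 2 * (‖x‖ ^ 2 - (z * inner ℂ x (S x)).re) := by
    intro z x
    have e2 : inner ℂ x x = ((‖x‖ ^ 2 : ℝ) : ℂ) := by
      rw [inner_self_eq_norm_sq_to_K]; push_cast; rfl
    rw [sub_apply, inner_sub_right, Complex.sub_re, re_inner_twiceRe,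
      smul_apply, ContinuousLinearMap.id_apply, inner_smul_right, e2]
    simp only [Complex.mul_re, Complex.ofReal_re, Complex.ofReal_im, Complex.re_ofNat]
    ring
  have hDs : ∀ (z : ℂ) (x y : H), inner ℂ (((2 : ℂ) • ContinuousLinearMap.id ℂ H -
      twiceRe z S) x) y = inner ℂ x (((2 : ℂ) • ContinuousLinearMap.id ℂ H - twiceRe z S) y) := by
    intro z x y
    simp [sub_apply, twiceRe_symm, mul_comm]
  have hDp : ∀ (z : ℂ), ‖z‖ ≤ √(1 + σ ^ 2) → ∀ x : H,
      0 ≤ ‖x‖ ^ 2 - (z * inner ℂ x (S x)).re := by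
    intro z hz x
    have := hw.re_le z hz x
    rw [ht, one_mul] at this
    linarith
  have hlim : ∀ c : ℝ, Tendsto (fun m => c * (‖f m‖ ^ 2 + ‖h m‖ ^ 2 -
      (inner ℂ (f m - h m) (S (f m + h m))).re)) atTop (𝓝 0) := fun c => by
    have := hfh.const_mul c
    rwa [mul_zero] at this
  have key := fun m => certificate_identity hσ hk hσκ hk2 S (f m) (h m)
  have par := fun m => norm_add_I_smul_sq (f m) (h m)
  have p1 := fun m => (hS.nonneg hκ ((σ * κ : ℂ) • f m - (Complex.I * (k + 1)) • h m)).1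
  have p2 := fun m => (hS.nonneg hκ ((σ * κ : ℂ) • f m + (Complex.I * (k + 1)) • h m)).2
  have p3 := fun m => hDp _ (norm_coeff hk2).1.le (f m + Complex.I • h m)
  have p4 := fun m => hDp _ (norm_coeff hk2).2.le (f m - Complex.I • h m)
  have hc : 0 < (2 * σ * (k + 1))⁻¹ := by positivity
  have hd : ∀ t : ℝ, 2 * t = (2 * (2 * σ * (k + 1))) * ((2 * σ * (k + 1))⁻¹ * t) := by
    intro t; field_simp
  refine ⟨?_, ?_, ?_, ?_⟩
  · refine tendsto_apply_zero (twiceRe_symm _ _)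
      (fun x => by rw [re_inner_twiceRe]; linarith [(hS.nonneg hκ x).1]) ?_
    simp only [re_inner_twiceRe]
    refine squeeze_zero (fun m => by linarith [p1 m]) (fun m => ?_)
      (hlim (2 * (2 * σ * (k + 1))))
    rw [hd]
    refine mul_le_mul_of_nonneg_left ?_ (by positivity)
    have := mul_nonneg hc.le (p2 m)
    linarith [key m, par m, p3 m, p4 m]
  · refine tendsto_apply_zero (twiceRe_symm _ _)
      (fun x => by rw [re_inner_twiceRe]; linarith [(hS.nonneg hκ x).2]) ?_
    simp only [re_inner_twiceRe]
    refine squeeze_zero (fun m => by linarith [p2 m]) (fun m => ?_)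
      (hlim (2 * (2 * σ * (k + 1))))
    rw [hd]
    refine mul_le_mul_of_nonneg_left ?_ (by positivity)
    have := mul_nonneg hc.le (p1 m)
    linarith [key m, par m, p3 m, p4 m]
  · refine tendsto_apply_zero (hDs _)
      (fun x => by rw [hD]; linarith [hDp _ (norm_coeff hk2).1.le x]) ?_
    simp only [hD]
    refine squeeze_zero (fun m => by linarith [p3 m]) (fun m => ?_)
      (hlim 4)
    have := mul_nonneg hc.le (add_nonneg (p1 m) (p2 m))
    linarith [key m, par m, p3 m, p4 m]
  · refine tendsto_apply_zero (hDs _)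
      (fun x => by rw [hD]; linarith [hDp _ (norm_coeff hk2).2.le x]) ?_
    simp only [hD]
    refine squeeze_zero (fun m => by linarith [p4 m]) (fun m => ?_)
      (hlim 4)
    have := mul_nonneg hc.le (add_nonneg (p1 m) (p2 m))
    linarith [key m, par m, p3 m, p4 m]

theorem tendsto_near_extremal {σ κ k : ℝ} (hσ : 0 < σ) (hκ : 0 < κ) (hk : 0 < k)
    (hσκ : σ ^ 2 + κ ^ 2 = 1) (hk2 : k ^ 2 = 1 + σ ^ 2 - σ ^ 4) {S : H →L[ℂ] H}
    (hS : IsSectorial σ κ S) (hw : RadiusLE (√(1 + σ ^ 2))⁻¹ S) {f h : ℕ → H}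
    (hfh : Tendsto (fun m => ‖f m‖ ^ 2 + ‖h m‖ ^ 2 -
      (inner ℂ (f m - h m) (S (f m + h m))).re) atTop (𝓝 0)) :
    Tendsto (fun m => S (f m) - (((k + σ ^ 2) / (1 + 2 * σ ^ 2) : ℝ) : ℂ) • f m +
      (((1 + σ ^ 2 + k) / (1 + 2 * σ ^ 2) : ℝ) : ℂ) • h m) atTop (𝓝 0) ∧
    Tendsto (fun m => S.adjoint (f m) - (((k + σ ^ 2) / (1 + 2 * σ ^ 2) : ℝ) : ℂ) • f m -
      (((1 + σ ^ 2 + k) / (1 + 2 * σ ^ 2) : ℝ) : ℂ) • h m) atTop (𝓝 0) ∧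
    Tendsto (fun m => S (h m) - (((k - σ ^ 2) / (1 + 2 * σ ^ 2) : ℝ) : ℂ) • h m -
      (((1 + σ ^ 2 - k) / (1 + 2 * σ ^ 2) : ℝ) : ℂ) • f m) atTop (𝓝 0) ∧
    Tendsto (fun m => S.adjoint (h m) - (((k - σ ^ 2) / (1 + 2 * σ ^ 2) : ℝ) : ℂ) • h m +
      (((1 + σ ^ 2 - k) / (1 + 2 * σ ^ 2) : ℝ) : ℂ) • f m) atTop (𝓝 0) := by
  obtain ⟨t1, t2, t3, t4⟩ := tendsto_contact_vectors hσ hκ hk hσκ hk2 hS hw hfh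
  have hσC : (σ : ℂ) ≠ 0 := by exact_mod_cast hσ.ne'
  have hκC : (κ : ℂ) ≠ 0 := by exact_mod_cast hκ.ne'
  refine tendsto_of_linear_system hσ hk hσκ hk2 ?_ ?_ ?_ ?_
  · have := (t1.add t2).const_smul ((4 * κ)⁻¹ : ℂ)
    rw [add_zero, smul_zero] at this
    refine this.congr fun m => ?_
    simp only [twiceRe, add_apply, smul_apply, map_add,
      map_sub, map_smul, map_mul, Complex.conj_I, Complex.conj_ofReal]
    match_scalars <;> field_simp <;> ring_nf <;> simp only [Complex.I_sq] <;> ring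
  · have := (t3.add t4).const_smul (4⁻¹ : ℂ)
    rw [add_zero, smul_zero] at this
    refine this.congr fun m => ?_
    simp only [twiceRe, add_apply, sub_apply,
      ContinuousLinearMap.id_apply, smul_apply, map_add,
      map_sub, map_smul, map_mul, map_pow, Complex.conj_I, Complex.conj_ofReal]
    match_scalars <;> field_simp <;> ring_nf <;> simp only [Complex.I_sq] <;> ring
  · have := (t1.sub t2).const_smul (Complex.I * (4 * σ)⁻¹ : ℂ)
    rw [sub_zero, smul_zero] at this
    refine this.congr fun m => ?_
    simp only [twiceRe, add_apply, smul_apply, map_add,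
      map_sub, map_smul, map_mul, Complex.conj_I, Complex.conj_ofReal]
    match_scalars <;> field_simp <;> ring_nf <;> simp only [Complex.I_sq] <;> ring
  · have := (t3.sub t4).const_smul (-Complex.I * 4⁻¹ : ℂ)
    rw [sub_zero, smul_zero] at this
    refine this.congr fun m => ?_
    simp only [twiceRe, add_apply, sub_apply,
      ContinuousLinearMap.id_apply, smul_apply, map_add,
      map_sub, map_smul, map_mul, map_pow, Complex.conj_I, Complex.conj_ofReal]
    match_scalars <;> field_simp <;> ring_nf <;> simp only [Complex.I_sq] <;> ring

end NearExtremal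

/-! ### An asymptotically orthonormal pair on which `S` acts as `B / ‖B‖` -/

section ApproximatePair

variable {H : Type*} [NormedAddCommGroup H] [InnerProductSpace ℂ H]

theorem tendsto_inner_zero_right {u v : ℕ → H} (hu : ∀ m, ‖u m‖ ≤ 2)
    (hv : Tendsto v atTop (𝓝 0)) : Tendsto (fun m => inner ℂ (u m) (v m)) atTop (𝓝 0) := by
  rw [tendsto_zero_iff_norm_tendsto_zero] at hv ⊢
  refine squeeze_zero (fun _ => norm_nonneg _) (fun m => ?_)
    (by simpa using hv.const_mul 2 : Tendsto (fun m => 2 * ‖v m‖) atTop (𝓝 0))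
  exact (norm_inner_le_norm _ _).trans (mul_le_mul_of_nonneg_right (hu m) (norm_nonneg _))

theorem tendsto_inner_zero_left {u v : ℕ → H} (hu : ∀ m, ‖u m‖ ≤ 2)
    (hv : Tendsto v atTop (𝓝 0)) : Tendsto (fun m => inner ℂ (v m) (u m)) atTop (𝓝 0) := by
  have := (Complex.continuous_conj.tendsto 0).comp (tendsto_inner_zero_right hu hv)
  rw [map_zero] at this
  exact this.congr fun m => inner_conj_symm _ _

theorem exists_tendsto_norm_apply (S : H →L[ℂ] H) :
    ∃ x : ℕ → H, (∀ m, ‖x m‖ ≤ 1) ∧ Tendsto (fun m => ‖S (x m)‖) atTop (𝓝 ‖S‖) := by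
  have h : ∀ m : ℕ, ∃ x : H, ‖x‖ ≤ 1 ∧ ‖S‖ - 1 / ((m : ℝ) + 1) < ‖S x‖ := by
    intro m
    have h1 : (0 : ℝ) < 1 / ((m : ℝ) + 1) := by positivity
    by_cases h2 : 0 ≤ ‖S‖ - 1 / ((m : ℝ) + 1)
    · obtain ⟨x, hx, hS⟩ := S.exists_lt_apply_of_lt_opNorm (r := ‖S‖ - 1 / ((m : ℝ) + 1))
        (by linarith)
      exact ⟨x, hx.le, hS⟩
    · exact ⟨0, by simp, by rw [map_zero, norm_zero]; linarith⟩
  choose x hx hS using h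
  refine ⟨x, hx, tendsto_of_tendsto_of_tendsto_of_le_of_le ?_ tendsto_const_nhds
    (fun m => (hS m).le) (fun m => ?_)⟩
  · simpa using tendsto_const_nhds.sub (tendsto_one_div_add_atTop_nhds_zero_nat (𝕜 := ℝ))
  · exact (S.le_opNorm _).trans (mul_le_of_le_one_right (norm_nonneg _) (hx m))

variable [CompleteSpace H]

/-- Computing `⟨h, Sf⟩ = ⟨S*h, f⟩` and `⟨h, S*f⟩ = ⟨Sh, f⟩` in two ways gives two relations. Their
sum isolates `⟨h, f⟩`, with a coefficient that is nonzero because `σ ≠ 0`; their difference gives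
the ratio of `‖h‖²` to `‖f‖²`. -/
theorem tendsto_gram {σ k : ℝ} (hσ : 0 < σ) {S : H →L[ℂ] H} {f h : ℕ → H}
    (hf : ∀ m, ‖f m‖ ≤ 2) (hh : ∀ m, ‖h m‖ ≤ 2)
    (hsum : Tendsto (fun m => ‖f m‖ ^ 2 + ‖h m‖ ^ 2) atTop (𝓝 1))
    (h₁ : Tendsto (fun m => S (f m) - (((k + σ ^ 2) / (1 + 2 * σ ^ 2) : ℝ) : ℂ) • f m +
      (((1 + σ ^ 2 + k) / (1 + 2 * σ ^ 2) : ℝ) : ℂ) • h m) atTop (𝓝 0))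
    (h₂ : Tendsto (fun m => S.adjoint (f m) -
      (((k + σ ^ 2) / (1 + 2 * σ ^ 2) : ℝ) : ℂ) • f m -
      (((1 + σ ^ 2 + k) / (1 + 2 * σ ^ 2) : ℝ) : ℂ) • h m) atTop (𝓝 0))
    (h₃ : Tendsto (fun m => S (h m) - (((k - σ ^ 2) / (1 + 2 * σ ^ 2) : ℝ) : ℂ) • h m -
      (((1 + σ ^ 2 - k) / (1 + 2 * σ ^ 2) : ℝ) : ℂ) • f m) atTop (𝓝 0))
    (h₄ : Tendsto (fun m => S.adjoint (h m) -
      (((k - σ ^ 2) / (1 + 2 * σ ^ 2) : ℝ) : ℂ) • h m +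
      (((1 + σ ^ 2 - k) / (1 + 2 * σ ^ 2) : ℝ) : ℂ) • f m) atTop (𝓝 0)) :
    Tendsto (fun m => ‖f m‖ ^ 2) atTop (𝓝 ((1 + σ ^ 2 + k) / (2 * (1 + σ ^ 2)))) ∧
    Tendsto (fun m => ‖h m‖ ^ 2) atTop (𝓝 ((1 + σ ^ 2 - k) / (2 * (1 + σ ^ 2)))) ∧
    Tendsto (fun m => inner ℂ (h m) (f m)) atTop (𝓝 0) := by
  have n0 : 1 + 2 * σ ^ 2 ≠ 0 := by positivity
  have s0 : 1 + σ ^ 2 ≠ 0 := by positivity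
  have nC : (1 + 2 * σ ^ 2 : ℂ) ≠ 0 := by exact_mod_cast n0
  have sC : (1 + σ ^ 2 : ℂ) ≠ 0 := by exact_mod_cast s0
  have σC : (σ : ℂ) ≠ 0 := by exact_mod_cast hσ.ne'
  have e : ∀ x : H, inner ℂ x x = ((‖x‖ ^ 2 : ℝ) : ℂ) := by
    intro x
    rw [inner_self_eq_norm_sq_to_K]; push_cast; rfl
  have t1 := (tendsto_inner_zero_right hh h₁).sub (tendsto_inner_zero_left hf h₄)
  have t2 := (tendsto_inner_zero_right hh h₂).sub (tendsto_inner_zero_left hf h₃)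
  rw [sub_zero] at t1 t2
  simp only [inner_add_left, inner_add_right, inner_sub_left, inner_sub_right, inner_smul_left,
    inner_smul_right, ContinuousLinearMap.adjoint_inner_left,
    ContinuousLinearMap.adjoint_inner_right, e, Complex.conj_ofReal] at t1 t2
  have hin : Tendsto (fun m => inner ℂ (h m) (f m)) atTop (𝓝 0) := by
    have := (t1.add t2).const_mul ((-((1 + 2 * σ ^ 2) / (4 * σ ^ 2)) : ℝ) : ℂ)
    rw [add_zero, mul_zero] at this
    refine this.congr fun m => ?_
    push_cast
    field_simp
    ring
  have hd : Tendsto (fun m => (1 + σ ^ 2 + k) * ‖h m‖ ^ 2 - (1 + σ ^ 2 - k) * ‖f m‖ ^ 2) atTop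
      (𝓝 0) := by
    have := (t1.sub t2).const_mul (((1 + 2 * σ ^ 2) / 2 : ℝ) : ℂ)
    rw [sub_zero, mul_zero] at this
    have := (Complex.continuous_re.tendsto 0).comp this
    rw [Complex.zero_re] at this
    refine this.congr fun m => ?_
    rw [Function.comp_apply, ← Complex.ofReal_re ((1 + σ ^ 2 + k) * ‖h m‖ ^ 2 -
      (1 + σ ^ 2 - k) * ‖f m‖ ^ 2)]
    congr 1
    push_cast
    field_simp
    ring
  refine ⟨?_, ?_, hin⟩
  · have := ((hsum.const_mul (1 + σ ^ 2 + k)).sub hd).div_const (2 * (1 + σ ^ 2))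
    rw [sub_zero, mul_one] at this
    refine this.congr fun m => ?_
    field_simp
    ring
  · have := ((hsum.const_mul (1 + σ ^ 2 - k)).add hd).div_const (2 * (1 + σ ^ 2))
    rw [add_zero, mul_one] at this
    refine this.congr fun m => ?_
    field_simp
    ring

theorem exists_approximate_pair {σ κ k n : ℝ} (hσ : 0 < σ) (hκ : 0 < κ) (hk : 0 < k)
    (hσκ : σ ^ 2 + κ ^ 2 = 1) (hk2 : k ^ 2 = 1 + σ ^ 2 - σ ^ 4) (hn : 0 < n)
    (hn2 : n ^ 2 = 1 + 2 * σ ^ 2) {S : H →L[ℂ] H}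
    (hS : IsSectorial σ κ S) (hw : RadiusLE (√(1 + σ ^ 2))⁻¹ S) (hS1 : ‖S‖ = 1) :
    ∃ F G : ℕ → H, Tendsto (fun m => ‖F m‖) atTop (𝓝 1) ∧ Tendsto (fun m => ‖G m‖) atTop (𝓝 1) ∧
      Tendsto (fun m => inner ℂ (F m) (G m)) atTop (𝓝 0) ∧
      Tendsto (fun m => S (F m) - ((((k + σ ^ 2) / n ^ 2 : ℝ) : ℂ) • F m +
        ((-(σ / n) : ℝ) : ℂ) • G m)) atTop (𝓝 0) ∧
      Tendsto (fun m => S (G m) - (((σ / n : ℝ) : ℂ) • F m +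
        (((k - σ ^ 2) / n ^ 2 : ℝ) : ℂ) • G m)) atTop (𝓝 0) ∧
      Tendsto (fun m => S.adjoint (F m) - ((((k + σ ^ 2) / n ^ 2 : ℝ) : ℂ) • F m +
        ((σ / n : ℝ) : ℂ) • G m)) atTop (𝓝 0) ∧
      Tendsto (fun m => S.adjoint (G m) - (((-(σ / n) : ℝ) : ℂ) • F m +
        (((k - σ ^ 2) / n ^ 2 : ℝ) : ℂ) • G m)) atTop (𝓝 0) := by
  obtain ⟨x, hx, hSx⟩ := exists_tendsto_norm_apply S
  rw [hS1] at hSx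
  have hSle : ∀ y, ‖S y‖ ≤ ‖y‖ := fun y => by simpa [hS1] using S.le_opNorm y
  have hx1 : Tendsto (fun m => ‖x m‖) atTop (𝓝 1) :=
    tendsto_of_tendsto_of_tendsto_of_le_of_le hSx tendsto_const_nhds (fun m => hSle (x m)) hx
  obtain ⟨f, hf⟩ : ∃ f : ℕ → H, ∀ m, f m = (1 / 2 : ℂ) • (x m + S (x m)) := ⟨_, fun _ => rfl⟩
  obtain ⟨h, hh⟩ : ∃ h : ℕ → H, ∀ m, h m = (1 / 2 : ℂ) • (x m - S (x m)) := ⟨_, fun _ => rfl⟩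
  have hadd : ∀ m, f m + h m = x m := fun m => by rw [hf, hh]; module
  have hsub : ∀ m, f m - h m = S (x m) := fun m => by rw [hf, hh]; module
  have hsq : ∀ m, ‖f m‖ ^ 2 + ‖h m‖ ^ 2 = (‖x m‖ ^ 2 + ‖S (x m)‖ ^ 2) / 2 := by
    intro m
    have := norm_add_sq_add_norm_sub_sq (f m) (h m)
    rw [hadd, hsub] at this
    linarith
  have hfle : ∀ m, ‖f m‖ ≤ 2 := fun m => by
    have := hx m; have := hSle (x m); have := norm_nonneg (S (x m)); have := norm_nonneg (x m)
    nlinarith [hsq m, sq_nonneg ‖h m‖]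
  have hhle : ∀ m, ‖h m‖ ≤ 2 := fun m => by
    have := hx m; have := hSle (x m); have := norm_nonneg (S (x m)); have := norm_nonneg (x m)
    nlinarith [hsq m, sq_nonneg ‖f m‖]
  have hsum : Tendsto (fun m => ‖f m‖ ^ 2 + ‖h m‖ ^ 2) atTop (𝓝 1) := by
    simp only [hsq]
    have := ((hx1.pow 2).add (hSx.pow 2)).div_const 2
    norm_num at this
    exact this
  have hfh : Tendsto (fun m => ‖f m‖ ^ 2 + ‖h m‖ ^ 2 -
      (inner ℂ (f m - h m) (S (f m + h m))).re) atTop (𝓝 0) := by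
    have := hsum.sub (hSx.pow 2)
    norm_num at this
    refine this.congr fun m => ?_
    rw [hadd, hsub, inner_self_eq_norm_sq_to_K]
    norm_cast
  obtain ⟨h₁, h₂, h₃, h₄⟩ := tendsto_near_extremal hσ hκ hk hσκ hk2 hS hw hfh
  obtain ⟨hP, hQ, hin⟩ := tendsto_gram hσ hfle hhle hsum h₁ h₂ h₃ h₄
  rw [← hn2] at h₁ h₂ h₃ h₄
  have hP0 : 0 < (1 + σ ^ 2 + k) / (2 * (1 + σ ^ 2)) := by positivity
  obtain ⟨p, hp⟩ : ∃ p, p = √((1 + σ ^ 2 + k) / (2 * (1 + σ ^ 2))) := ⟨_, rfl⟩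
  have hp0 : 0 < p := by rw [hp]; exact Real.sqrt_pos.2 hP0
  have hp2 : p ^ 2 = (1 + σ ^ 2 + k) / (2 * (1 + σ ^ 2)) := by rw [hp]; exact Real.sq_sqrt hP0.le
  have s0 : (1 + σ ^ 2) ≠ 0 := by positivity
  have r0 : (1 + σ ^ 2 + k) ≠ 0 := by positivity
  -- `p` and `q` are the limits of `‖f‖` and `‖h‖`. Defining `q` through `p` rather than by a square
  -- root makes `rel₁` immediate; normalisation then turns both off-diagonal coefficients into `±
  -- σ/n`.
  obtain ⟨q, hq⟩ : ∃ q, q = σ * n * p / (1 + σ ^ 2 + k) := ⟨_, rfl⟩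
  have hq0 : 0 < q := by rw [hq]; positivity
  have hq2 : q ^ 2 = (1 + σ ^ 2 - k) / (2 * (1 + σ ^ 2)) := by
    rw [hq, div_pow, mul_pow, mul_pow, hn2, hp2]
    field_simp
    linear_combination hk2
  have rel₁ : σ / n * p = (1 + σ ^ 2 + k) / n ^ 2 * q := by rw [hq]; field_simp
  have rel₂ : σ / n * q = (1 + σ ^ 2 - k) / n ^ 2 * p := by
    rw [hq]; field_simp
    linear_combination σ ^ 2 * hn2 + hk2
  have c₁ : (1 + σ ^ 2 + k) / n ^ 2 * p⁻¹ = σ / n * q⁻¹ := by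
    field_simp at rel₁ ⊢; linarith
  have c₂ : (1 + σ ^ 2 - k) / n ^ 2 * q⁻¹ = σ / n * p⁻¹ := by
    field_simp at rel₂ ⊢; linarith
  have hpn : Tendsto (fun m => ‖f m‖) atTop (𝓝 p) := by
    have := hP.sqrt
    rw [← hp2, Real.sqrt_sq hp0.le] at this
    exact this.congr fun m => Real.sqrt_sq (norm_nonneg _)
  have hqn : Tendsto (fun m => ‖h m‖) atTop (𝓝 q) := by
    have := hQ.sqrt
    rw [← hq2, Real.sqrt_sq hq0.le] at this
    exact this.congr fun m => Real.sqrt_sq (norm_nonneg _)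
  refine ⟨fun m => ((p⁻¹ : ℝ) : ℂ) • f m, fun m => ((q⁻¹ : ℝ) : ℂ) • h m, ?_, ?_, ?_, ?_, ?_,
    ?_, ?_⟩
  · have := hpn.const_mul p⁻¹
    rw [inv_mul_cancel₀ hp0.ne'] at this
    refine this.congr fun m => ?_
    rw [norm_smul, Complex.norm_real, Real.norm_of_nonneg (by positivity)]
  · have := hqn.const_mul q⁻¹
    rw [inv_mul_cancel₀ hq0.ne'] at this
    refine this.congr fun m => ?_
    rw [norm_smul, Complex.norm_real, Real.norm_of_nonneg (by positivity)]
  · have := ((Complex.continuous_conj.tendsto 0).comp hin).const_mul ((p⁻¹ * q⁻¹ : ℝ) : ℂ)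
    rw [map_zero, mul_zero] at this
    refine this.congr fun m => ?_
    rw [Function.comp_apply, inner_conj_symm, inner_smul_left, inner_smul_right,
      Complex.conj_ofReal]
    push_cast; ring
  all_goals
    have c₁' : (((1 + σ ^ 2 + k) / n ^ 2 : ℝ) : ℂ) * ((p⁻¹ : ℝ) : ℂ) =
      ((σ / n : ℝ) : ℂ) * ((q⁻¹ : ℝ) : ℂ) := by exact_mod_cast c₁
    have c₂' : (((1 + σ ^ 2 - k) / n ^ 2 : ℝ) : ℂ) * ((q⁻¹ : ℝ) : ℂ) =
      ((σ / n : ℝ) : ℂ) * ((p⁻¹ : ℝ) : ℂ) := by exact_mod_cast c₂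
  · have := h₁.const_smul ((p⁻¹ : ℝ) : ℂ)
    rw [smul_zero] at this
    refine this.congr fun m => ?_
    simp only [map_smul, Complex.ofReal_neg]
    linear_combination (norm := module) c₁' • h m
  · have := h₃.const_smul ((q⁻¹ : ℝ) : ℂ)
    rw [smul_zero] at this
    refine this.congr fun m => ?_
    simp only [map_smul]
    linear_combination (norm := module) (-1 : ℂ) • c₂' • f m
  · have := h₂.const_smul ((p⁻¹ : ℝ) : ℂ)
    rw [smul_zero] at this
    refine this.congr fun m => ?_
    simp only [map_smul]
    linear_combination (norm := module) (-1 : ℂ) • c₁' • h m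
  · have := h₄.const_smul ((q⁻¹ : ℝ) : ℂ)
    rw [smul_zero] at this
    refine this.congr fun m => ?_
    simp only [map_smul, Complex.ofReal_neg]
    linear_combination (norm := module) c₂' • f m

end ApproximatePair

/-! ### Rotation to a fixed plane and block estimates -/

section Blocks

variable {H : Type*} [NormedAddCommGroup H] [InnerProductSpace ℂ H]

theorem tendsto_normalize_sub {u : ℕ → H} (hu : Tendsto (fun m => ‖u m‖) atTop (𝓝 1)) :
    Tendsto (fun m => ((‖u m‖⁻¹ : ℝ) : ℂ) • u m - u m) atTop (𝓝 0) := by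
  rw [tendsto_zero_iff_norm_tendsto_zero]
  have := ((hu.inv₀ one_ne_zero).sub_const 1).norm.mul hu
  rw [inv_one, sub_self, norm_zero, zero_mul] at this
  refine this.congr fun m => ?_
  have e : ((‖u m‖⁻¹ : ℝ) : ℂ) • u m - u m = ((‖u m‖⁻¹ - 1 : ℝ) : ℂ) • u m := by
    push_cast; module
  rw [e, norm_smul, Complex.norm_real]

theorem norm_normalize {u : H} (hu : u ≠ 0) : ‖((‖u‖⁻¹ : ℝ) : ℂ) • u‖ = 1 := by
  rw [norm_smul, Complex.norm_real, Real.norm_of_nonneg (by positivity),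
    inv_mul_cancel₀ (norm_ne_zero_iff.2 hu)]

/-- An asymptotically orthonormal pair is close to an orthonormal one. -/
theorem exists_orthonormal_near {e : Fin 2 → H} (he : Orthonormal ℂ e) {F G : ℕ → H}
    (hF : Tendsto (fun m => ‖F m‖) atTop (𝓝 1)) (hG : Tendsto (fun m => ‖G m‖) atTop (𝓝 1))
    (hFG : Tendsto (fun m => inner ℂ (F m) (G m)) atTop (𝓝 0)) :
    ∃ E : ℕ → Fin 2 → H, (∀ m, Orthonormal ℂ (E m)) ∧
      Tendsto (fun m => E m 0 - F m) atTop (𝓝 0) ∧ Tendsto (fun m => E m 1 - G m) atTop (𝓝 0) := by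
  classical
  obtain ⟨u, hu⟩ : ∃ u : ℕ → H, ∀ m, u m = ((‖F m‖⁻¹ : ℝ) : ℂ) • F m := ⟨_, fun _ => rfl⟩
  obtain ⟨v, hv⟩ : ∃ v : ℕ → H, ∀ m, v m = G m - inner ℂ (u m) (G m) • u m := ⟨_, fun _ => rfl⟩
  have huF : Tendsto (fun m => u m - F m) atTop (𝓝 0) := by
    simpa only [hu] using tendsto_normalize_sub hF
  have hF0 : ∀ᶠ m in atTop, F m ≠ 0 := by
    filter_upwards [hF.eventually_ne one_ne_zero] with m hm
    exact norm_ne_zero_iff.1 hm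
  have hvG : Tendsto (fun m => v m - G m) atTop (𝓝 0) := by
    rw [tendsto_zero_iff_norm_tendsto_zero]
    have h1 := ((hF.inv₀ one_ne_zero).mul hFG.norm)
    rw [norm_zero, mul_zero] at h1
    refine h1.congr' ?_
    filter_upwards [hF0] with m hm
    have : v m - G m = -(inner ℂ (u m) (G m) • u m) := by rw [hv]; abel
    rw [this, norm_neg, norm_smul, hu, norm_normalize hm, mul_one, inner_smul_left, norm_mul,
      Complex.conj_ofReal, Complex.norm_real, Real.norm_of_nonneg (by positivity)]
  have hv1 : Tendsto (fun m => ‖v m‖) atTop (𝓝 1) := by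
    have h1 : Tendsto (fun m => ‖v m‖ - ‖G m‖) atTop (𝓝 0) :=
      squeeze_zero_norm (fun m => abs_norm_sub_norm_le _ _)
        (tendsto_zero_iff_norm_tendsto_zero.1 hvG)
    simpa using h1.add hG
  have hv0 : ∀ᶠ m in atTop, v m ≠ 0 := by
    filter_upwards [hv1.eventually_ne one_ne_zero] with m hm
    exact norm_ne_zero_iff.1 hm
  -- Gram–Schmidt; for the finitely many `m` where it breaks down, `e` serves as default.
  refine ⟨fun m => if F m ≠ 0 ∧ v m ≠ 0 then ![u m, ((‖v m‖⁻¹ : ℝ) : ℂ) • v m] else e, ?_, ?_, ?_⟩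
  · intro m
    dsimp only
    split_ifs with h
    · have hu1 : ‖u m‖ = 1 := by rw [hu]; exact norm_normalize h.1
      have huv : inner ℂ (u m) (v m) = 0 := by
        rw [hv, inner_sub_right, inner_smul_right, inner_self_eq_norm_sq_to_K, hu1]
        simp
      rw [orthonormal_vecCons_iff]
      refine ⟨hu1, fun i => ?_, ?_⟩
      · simp [inner_smul_right, huv]
      · rw [orthonormal_vecCons_iff]
        exact ⟨norm_normalize h.2, fun i => i.elim0, ⟨fun i => i.elim0, fun i => i.elim0⟩⟩
    · exact he
  · refine huF.congr' ?_
    filter_upwards [hF0, hv0] with m h1 h2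
    simp [h1, h2]
  · have := (tendsto_normalize_sub hv1).add hvG
    rw [add_zero] at this
    refine this.congr' ?_
    filter_upwards [hF0, hv0] with m h1 h2
    simp [h1, h2]

theorem tendsto_apply_sub_congr {R : H →L[ℂ] H} {F G F' G' u u' : ℕ → H} {a b : ℂ}
    (h : Tendsto (fun m => R (u m) - (a • F m + b • G m)) atTop (𝓝 0))
    (hF : Tendsto (fun m => F' m - F m) atTop (𝓝 0))
    (hG : Tendsto (fun m => G' m - G m) atTop (𝓝 0))
    (hu : Tendsto (fun m => u' m - u m) atTop (𝓝 0)) :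
    Tendsto (fun m => R (u' m) - (a • F' m + b • G' m)) atTop (𝓝 0) := by
  have hR := (R.continuous.tendsto 0).comp hu
  rw [map_zero] at hR
  have := ((h.add hR).sub (hF.const_smul a)).sub (hG.const_smul b)
  simp only [add_zero, smul_zero, sub_zero] at this
  refine this.congr fun m => ?_
  rw [Function.comp_apply, map_sub]
  module

/-- A linear isometry of a finite-dimensional subspace onto itself, extended by the identity. -/
theorem exists_linearIsometryEquiv_extend (M : Submodule ℂ H) [FiniteDimensional ℂ M]
    (L : M ≃ₗᵢ[ℂ] M) : ∃ V : H ≃ₗᵢ[ℂ] H, ∀ x : M, V x = L x := by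
  have aux : ∀ L : M ≃ₗᵢ[ℂ] M, ∃ V : H →ₗᵢ[ℂ] H,
      ∀ x, V x = L (M.orthogonalProjectionOnto x) + Mᗮ.orthogonalProjectionOnto x := by
    intro L
    refine ⟨⟨M.subtype ∘ₗ L.toLinearEquiv.toLinearMap ∘ₗ
      M.orthogonalProjectionOnto.toLinearMap + Mᗮ.subtype ∘ₗ
      Mᗮ.orthogonalProjectionOnto.toLinearMap, fun x => ?_⟩, fun x => rfl⟩
    rw [← sq_eq_sq₀ (norm_nonneg _) (norm_nonneg _),
      Submodule.norm_sq_eq_add_norm_sq_projection x M]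
    have := norm_add_sq_eq_norm_sq_add_norm_sq_of_inner_eq_zero (𝕜 := ℂ)
      (L (M.orthogonalProjectionOnto x) : H) (Mᗮ.orthogonalProjectionOnto x : H)
      (Submodule.inner_right_of_mem_orthogonal (SetLike.coe_mem _) (SetLike.coe_mem _))
    simp only [← sq] at this
    rw [← L.norm_map]
    exact this
  obtain ⟨V, hV⟩ := aux L
  -- The same extension of `L⁻¹` provides preimages, giving surjectivity even when `H` is
  -- infinite-dimensional.
  obtain ⟨V', hV'⟩ := aux L.symm
  have hsurj : Function.Surjective V := by
    intro x
    refine ⟨V' x, ?_⟩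
    have h1 : M.orthogonalProjectionOnto (V' x) = L.symm (M.orthogonalProjectionOnto x) := by
      rw [hV', map_add, Submodule.orthogonalProjectionOnto_mem_subspace_eq_self,
        Submodule.orthogonalProjectionOnto_apply_of_mem_orthogonal (SetLike.coe_mem _), add_zero]
    have h2 : Mᗮ.orthogonalProjectionOnto (V' x) = Mᗮ.orthogonalProjectionOnto x := by
      rw [hV', map_add, Submodule.orthogonalProjectionOnto_mem_subspace_eq_self,
        Submodule.orthogonalProjectionOnto_apply_of_mem_orthogonal
          (Submodule.le_orthogonal_orthogonal _ (SetLike.coe_mem _)), zero_add]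
    rw [hV, h1, h2, L.apply_symm_apply]
    exact M.starProjection_add_starProjection_orthogonal x
  refine ⟨LinearIsometryEquiv.ofSurjective V hsurj, fun x => ?_⟩
  rw [LinearIsometryEquiv.coe_ofSurjective, hV,
    Submodule.orthogonalProjectionOnto_mem_subspace_eq_self,
    Submodule.orthogonalProjectionOnto_apply_of_mem_orthogonal
      (Submodule.le_orthogonal_orthogonal _ (SetLike.coe_mem _))]
  simp

variable [CompleteSpace H]

/-- Inside the finite-dimensional span of both pairs, an isometry between the two planes extends to
a surjective isometry; the identity on the complement completes it. -/
theorem exists_unitary_map {e E : Fin 2 → H} (he : Orthonormal ℂ e) (hE : Orthonormal ℂ E) :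
    ∃ U : unitary (H →L[ℂ] H), ∀ i, (U : H →L[ℂ] H) (e i) = E i := by
  let M : Submodule ℂ H := plane e ⊔ plane E
  have hem : ∀ i, e i ∈ M := fun i =>
    Submodule.mem_sup_left (Submodule.subset_span (Set.mem_range_self i))
  have hEm : ∀ i, E i ∈ M := fun i =>
    Submodule.mem_sup_right (Submodule.subset_span (Set.mem_range_self i))
  let e' : Fin 2 → M := fun i => ⟨e i, hem i⟩
  let E' : Fin 2 → M := fun i => ⟨E i, hEm i⟩
  have he' : Orthonormal ℂ e' := (M.subtypeₗᵢ.orthonormal_comp_iff (v := e')).1 he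
  have hE' : Orthonormal ℂ E' := (M.subtypeₗᵢ.orthonormal_comp_iff (v := E')).1 hE
  let L := ((embedding hE').comp (embedding he').equivRange.symm.toLinearIsometry).extend
  have hsingle : ∀ {v : Fin 2 → M} (hv : Orthonormal ℂ v) (i : Fin 2),
      embedding hv (EuclideanSpace.basisFun (Fin 2) ℂ i) = v i := by
    intro v hv i
    have := Module.Basis.constr_basis (EuclideanSpace.basisFun (Fin 2) ℂ).toBasis ℂ v i
    rw [OrthonormalBasis.coe_toBasis] at this
    exact this
  have hL : ∀ i, L (e' i) = E' i := by
    intro i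
    have h1 : e' i = ((embedding he').equivRange (EuclideanSpace.basisFun (Fin 2) ℂ i) : M) :=
      (hsingle he' i).symm
    rw [h1, LinearIsometry.extend_apply]
    change embedding hE' ((embedding he').equivRange.symm ((embedding he').equivRange _)) = _
    rw [LinearIsometryEquiv.symm_apply_apply]
    exact hsingle hE' i
  obtain ⟨V, hV⟩ := exists_linearIsometryEquiv_extend M (L.toLinearIsometryEquiv rfl)
  refine ⟨Unitary.linearIsometryEquiv.symm V, fun i => ?_⟩
  have := hV (e' i)
  rw [LinearIsometry.coe_toLinearIsometryEquiv, hL] at this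
  exact this

omit [CompleteSpace H] in
-- The projection onto the complement kills every vector of the plane, so only the error of
-- approximating `A (e i)` inside the plane survives.
theorem norm_block_plane_le {e : Fin 2 → H} (he : Orthonormal ℂ e) (A : H →L[ℂ] H)
    (c : Fin 2 → Fin 2 → ℂ) :
    ‖block (plane e) (plane e)ᗮ A‖ ≤ ∑ i, ‖A (e i) - (c i 0 • e 0 + c i 1 • e 1)‖ := by
  refine ContinuousLinearMap.opNorm_le_bound _ (by positivity) fun v => ?_
  have hmem : ∀ i, e i ∈ plane e := fun i => Submodule.subset_span (Set.mem_range_self i)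
  obtain ⟨a, ha⟩ := (Submodule.mem_span_range_iff_exists_fun ℂ).1 v.2
  have hai : ∀ i, ‖a i‖ ≤ ‖v‖ := by
    intro i
    rw [← he.inner_right_fintype a i, ha, Submodule.coe_norm]
    simpa [he.1 i] using norm_inner_le_norm (𝕜 := ℂ) (e i) (v : H)
  have hP : ∀ i, (plane e)ᗮ.orthogonalProjectionOnto (A (e i)) =
      (plane e)ᗮ.orthogonalProjectionOnto (A (e i) - (c i 0 • e 0 + c i 1 • e 1)) := by
    intro i
    have h0 : (plane e)ᗮ.orthogonalProjectionOnto (c i 0 • e 0 + c i 1 • e 1) = 0 := by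
      refine Submodule.orthogonalProjectionOnto_apply_of_mem_orthogonal
        (Submodule.le_orthogonal_orthogonal _ ?_)
      exact Submodule.add_mem _ (Submodule.smul_mem _ _ (hmem 0)) (Submodule.smul_mem _ _ (hmem 1))
    rw [map_sub, h0, sub_zero]
  have hv : block (plane e) (plane e)ᗮ A v = ∑ i, a i •
      (plane e)ᗮ.orthogonalProjectionOnto (A (e i) - (c i 0 • e 0 + c i 1 • e 1)) := by
    change (plane e)ᗮ.orthogonalProjectionOnto (A v) = _
    rw [← ha, map_sum, map_sum]
    refine Finset.sum_congr rfl fun i _ => ?_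
    rw [map_smul, map_smul, hP]
  rw [hv, Finset.sum_mul]
  refine (norm_sum_le _ _).trans (Finset.sum_le_sum fun i _ => ?_)
  rw [norm_smul, mul_comm]
  exact mul_le_mul (Submodule.norm_orthogonalProjectionOnto_apply_le _ _) (hai i) (norm_nonneg _)
    (norm_nonneg _)

/-- The two blocks are adjoint to each other, which is why asymptotic relations for `S*` are needed
as well as for `S`. -/
theorem norm_block_orthogonal (e : Fin 2 → H) (A : H →L[ℂ] H) :
    ‖block (plane e)ᗮ (plane e) A‖ = ‖block (plane e) (plane e)ᗮ A.adjoint‖ := by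
  rw [← LinearIsometryEquiv.norm_map ContinuousLinearMap.adjoint
    (block (plane e) (plane e)ᗮ A.adjoint)]
  congr 1
  rw [ContinuousLinearMap.eq_adjoint_iff]
  intro v w
  have h1 : inner ℂ (block (plane e)ᗮ (plane e) A v) w = inner ℂ (A v) (w : H) :=
    Submodule.inner_orthogonalProjectionOnto_eq_of_mem_right w (A v)
  have h2 : inner ℂ v (block (plane e) (plane e)ᗮ A.adjoint w) =
      inner ℂ (v : H) (A.adjoint w) :=
    Submodule.inner_orthogonalProjectionOnto_eq_of_mem_left v (A.adjoint w)
  rw [h1, h2, ContinuousLinearMap.adjoint_inner_right]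

theorem tendsto_blocks {e : Fin 2 → H} (he : Orthonormal ℂ e) {A : ℕ → H →L[ℂ] H}
    {c c' : Fin 2 → Fin 2 → ℂ}
    (h : ∀ i, Tendsto (fun m => A m (e i) - (c i 0 • e 0 + c i 1 • e 1)) atTop (𝓝 0))
    (h' : ∀ i, Tendsto (fun m => (A m).adjoint (e i) - (c' i 0 • e 0 + c' i 1 • e 1))
      atTop (𝓝 0)) :
    Tendsto (fun m => leadingBlock e (A m)) atTop (𝓝 (Matrix.of fun i j => c j i)) ∧
      Tendsto (fun m => block (plane e)ᗮ (plane e) (A m)) atTop (𝓝 0) ∧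
      Tendsto (fun m => block (plane e) (plane e)ᗮ (A m)) atTop (𝓝 0) := by
  have aux : ∀ {R : ℕ → H →L[ℂ] H} {d : Fin 2 → Fin 2 → ℂ},
      (∀ i, Tendsto (fun m => R m (e i) - (d i 0 • e 0 + d i 1 • e 1)) atTop (𝓝 0)) →
      Tendsto (fun m => ‖block (plane e) (plane e)ᗮ (R m)‖) atTop (𝓝 0) := by
    intro R d hd
    refine squeeze_zero (fun m => norm_nonneg (block (plane e) (plane e)ᗮ (R m)))
      (fun m => norm_block_plane_le he (R m) d) ?_
    simpa using tendsto_finsetSum Finset.univ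
      fun i _ => tendsto_zero_iff_norm_tendsto_zero.1 (hd i)
  refine ⟨?_, ?_,
    (tendsto_zero_iff_norm_tendsto_zero (E := plane e →L[ℂ] ↥(plane e)ᗮ)).2 (aux h)⟩
  · refine tendsto_pi_nhds.2 fun i => tendsto_pi_nhds.2 fun j => ?_
    have h1 := ((continuous_const (y := e i)).inner (𝕜 := ℂ) continuous_id).tendsto 0 |>.comp (h j)
    have h2 := h1.add_const (c j i)
    simp only [id, inner_zero_right, zero_add] at h2
    refine h2.congr fun m => ?_
    have h3 : inner ℂ (e i) (c j 0 • e 0 + c j 1 • e 1) = c j i := by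
      have := he.inner_right_fintype (c j) i
      rwa [Fin.sum_univ_two] at this
    simp only [Function.comp_apply, inner_sub_right, h3, sub_add_cancel]
    rfl
  · refine (tendsto_zero_iff_norm_tendsto_zero (E := ↥(plane e)ᗮ →L[ℂ] plane e)).2 ?_
    simp only [norm_block_orthogonal]
    exact aux h'

theorem tendsto_conjugate {e : Fin 2 → H} {E : ℕ → Fin 2 → H} {U : ℕ → unitary (H →L[ℂ] H)}
    (hU : ∀ m i, (U m : H →L[ℂ] H) (e i) = E m i) {R : H →L[ℂ] H} {i : Fin 2} {a b : ℂ}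
    (h : Tendsto (fun m => R (E m i) - (a • E m 0 + b • E m 1)) atTop (𝓝 0)) :
    Tendsto (fun m => (star (U m : H →L[ℂ] H) * R * (U m : H →L[ℂ] H)) (e i) -
      (a • e 0 + b • e 1)) atTop (𝓝 0) := by
  rw [tendsto_zero_iff_norm_tendsto_zero] at h ⊢
  refine h.congr fun m => ?_
  have hs : ∀ j, star (U m : H →L[ℂ] H) (E m j) = e j := by
    intro j
    rw [← hU]
    exact congr($(Unitary.coe_star_mul_self (U m)) (e j))
  have e1 : (star (U m : H →L[ℂ] H) * R * (U m : H →L[ℂ] H)) (e i) - (a • e 0 + b • e 1) =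
      ((star (U m) : unitary (H →L[ℂ] H)) : H →L[ℂ] H)
        (R (E m i) - (a • E m 0 + b • E m 1)) := by
    rw [map_sub, map_add, map_smul, map_smul, Unitary.coe_star, hs, hs, ← hU m i]
    rfl
  rw [e1, Unitary.norm_map]

end Blocks

end SectorOperator

/-! ### Assembly for the normalised operator -/

theorem corollary3p5 {H : Type*} [NormedAddCommGroup H] [InnerProductSpace ℂ H]
    [CompleteSpace H] (hH : 1 < Module.rank ℂ H)
    (α : ℝ) (hα : α ∈ Set.Ioo 0 (Real.pi / 2))
    (T : H →L[ℂ] H)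
    (hW : SectorOperator.numericalRange T ⊆ SectorOperator.sector α)
    (hT : ∀ x : H, ‖x‖ = 1 → ‖T x‖ ≠ ‖T‖)
    (hτ : ‖T‖ / SectorOperator.numericalRadius T = SectorOperator.tau H α)
    (e : Fin 2 → H) (he : Orthonormal ℂ e) :
    ∃ U : ℕ → unitary (H →L[ℂ] H),
      let A : ℕ → (H →L[ℂ] H) := fun m =>
        ((‖T‖⁻¹ : ℝ) : ℂ) • (star (U m : H →L[ℂ] H) * T * (U m : H →L[ℂ] H))
      Tendsto (fun m => SectorOperator.leadingBlock e (A m)) atTop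
        (𝓝 (((SectorOperator.opNorm (SectorOperator.matrixB α))⁻¹ : ℂ) •
          SectorOperator.matrixB α)) ∧
      Tendsto (fun m => SectorOperator.block (SectorOperator.plane e)ᗮ
        (SectorOperator.plane e) (A m)) atTop (𝓝 0) ∧
      Tendsto (fun m => SectorOperator.block (SectorOperator.plane e)
        (SectorOperator.plane e)ᗮ (A m)) atTop (𝓝 0) := by
  open SectorOperator in
  obtain ⟨hσ, hκ, hk, hk2, hn, hn2, -⟩ := scalar_facts hα
  have ht : 0 < √(1 + Real.sin α ^ 2) := Real.sqrt_pos.2 (by positivity)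
  have hratio : √(1 + Real.sin α ^ 2) ≤ ‖T‖ / numericalRadius T := hτ ▸ le_tau hα he
  have hw0 : 0 < numericalRadius T := by
    refine (numericalRadius_nonneg T).lt_of_ne fun h => ?_
    -- Division by zero gives `0`, so `w(T) = 0` would contradict the positive lower bound on the
    -- ratio; this also excludes `T = 0`.
    rw [← h, div_zero] at hratio
    exact absurd ht hratio.not_gt
  have hle : √(1 + Real.sin α ^ 2) * numericalRadius T ≤ ‖T‖ := (le_div_iff₀ hw0).1 hratio
  have hT0 : 0 < ‖T‖ := (mul_pos ht hw0).trans_le hle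
  set S : H →L[ℂ] H := ((‖T‖⁻¹ : ℝ) : ℂ) • T with hS
  have hin : ∀ x, inner ℂ x (S x) = ((‖T‖⁻¹ : ℝ) : ℂ) * inner ℂ x (T x) := fun x => by
    rw [hS, smul_apply, inner_smul_right]
  have hS1 : ‖S‖ = 1 := by
    rw [hS, norm_smul, Complex.norm_real, Real.norm_of_nonneg (by positivity),
      inv_mul_cancel₀ hT0.ne']
  have hSs : IsSectorial (Real.sin α) (Real.cos α) S := by
    intro x
    have := mul_le_mul_of_nonneg_left (isSectorial_of_numericalRange_subset hα hW x)
      (inv_nonneg.2 hT0.le)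
    rw [hin, Complex.im_ofReal_mul, Complex.re_ofReal_mul, abs_mul, abs_of_nonneg (by positivity)]
    linarith
  have hSw : RadiusLE (√(1 + Real.sin α ^ 2))⁻¹ S := by
    intro x
    have h1 := radiusLE_numericalRadius T x
    have h2 : ‖T‖⁻¹ * numericalRadius T ≤ (√(1 + Real.sin α ^ 2))⁻¹ := by
      rw [inv_mul_le_iff₀ hT0, ← div_eq_mul_inv, le_div_iff₀ ht]
      linarith
    rw [hin, norm_mul, Complex.norm_real, Real.norm_of_nonneg (by positivity)]
    calc ‖T‖⁻¹ * ‖inner ℂ x (T x)‖ ≤ ‖T‖⁻¹ * (numericalRadius T * ‖x‖ ^ 2) := by gcongr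
      _ = ‖T‖⁻¹ * numericalRadius T * ‖x‖ ^ 2 := by ring
      _ ≤ _ := by gcongr
  obtain ⟨F, G, hF, hG, hFG, h₁, h₂, h₃, h₄⟩ := exists_approximate_pair hσ hκ hk
    (Real.sin_sq_add_cos_sq α) hk2 hn hn2 hSs hSw hS1
  obtain ⟨E, hE, hEF, hEG⟩ := exists_orthonormal_near he hF hG hFG
  choose U hU using fun m => exists_unitary_map he (hE m)
  refine ⟨U, ?_⟩
  have hA : ∀ m, ((‖T‖⁻¹ : ℝ) : ℂ) • (star (U m : H →L[ℂ] H) * T * (U m : H →L[ℂ] H)) =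
      star (U m : H →L[ℂ] H) * S * (U m : H →L[ℂ] H) := fun m => by
    rw [hS, mul_smul_comm, smul_mul_assoc]
  have hA' : ∀ m, (star (U m : H →L[ℂ] H) * S * (U m : H →L[ℂ] H)).adjoint =
      star (U m : H →L[ℂ] H) * S.adjoint * (U m : H →L[ℂ] H) := fun m => by
    rw [← ContinuousLinearMap.star_eq_adjoint, ← ContinuousLinearMap.star_eq_adjoint,
      star_mul, star_mul, star_star, mul_assoc]
  simp only [hA]
  set k := √(1 + Real.sin α ^ 2 - Real.sin α ^ 4) with hkd
  set n := √(1 + 2 * Real.sin α ^ 2) with hnd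
  have key := tendsto_blocks he
    (A := fun m => star (U m : H →L[ℂ] H) * S * (U m : H →L[ℂ] H))
    -- Row `i` of `c` holds the coordinates of the image of `e i`, so `c` is the transpose of `B /
    -- n`, and `c'` that of its adjoint.
    (c := ![![(((k + Real.sin α ^ 2) / n ^ 2 : ℝ) : ℂ), ((-(Real.sin α / n) : ℝ) : ℂ)],
      ![((Real.sin α / n : ℝ) : ℂ), (((k - Real.sin α ^ 2) / n ^ 2 : ℝ) : ℂ)]])
    (c' := ![![(((k + Real.sin α ^ 2) / n ^ 2 : ℝ) : ℂ), ((Real.sin α / n : ℝ) : ℂ)],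
      ![((-(Real.sin α / n) : ℝ) : ℂ), (((k - Real.sin α ^ 2) / n ^ 2 : ℝ) : ℂ)]])
    (Fin.forall_fin_two.2
      ⟨tendsto_conjugate hU (tendsto_apply_sub_congr h₁ hEF hEG hEF),
        tendsto_conjugate hU (tendsto_apply_sub_congr h₂ hEF hEG hEG)⟩)
    (by
      simp only [hA']
      exact Fin.forall_fin_two.2
        ⟨tendsto_conjugate hU (tendsto_apply_sub_congr h₃ hEF hEG hEF),
          tendsto_conjugate hU (tendsto_apply_sub_congr h₄ hEF hEG hEG)⟩)
  convert key using 3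
  have hnC : (n : ℂ) ≠ 0 := by exact_mod_cast hn.ne'
  rw [opNorm_matrixB hα, matrixB_eq, ← hnd, ← hkd]
  ext i j
  fin_cases i <;> fin_cases j <;> simp [-Complex.ofReal_sin] <;> field_simp
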